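/- Fix $p,d\ge 1$ and $q\ge1$. **Model.** Let $(X_i,\eta_i)_{i\ge1}$ be i.i.d. with $X_i\in\mathbb R^p$ and $\eta_i\in\mathbb R$ integrable, $E(\eta_i\mid X_i)=0$. Let $\beta_0\in\mathbb R^p\setminus\{0\}$, $\theta_0\in\mathbb R^d$, let $B$ be a $p\times q$ matrix with nonzero pairwise orthogonal columns whose column space contains $\beta_0$, and let $g(\cdot,\theta_0):\mathbb R\to\mathbb R$ and $G:\mathbb R^q\to\mathbb R$ be measurable. The null model is $Y_i=g(\beta_0^\top X_i,\theta_0)+\eta_i$; the local alternatives are $$H_{1n}:\quad Y_{n,i}=g(\beta_0^\top X_i,\theta_0)+C_n\,G(B^\top X_i)+\eta_i,\qquad C_n=\frac1{\sqrt n},\quad 1\le i\le n .$$ For a response $\zeta$, the central subspace $\mathcal S_{\zeta|X}$ is the smallest subspace $A\subset\mathbb R^p$ such that $\zeta$ and $X$ are conditionally independent given the orthogonal projection of $X$ onto $A$. Let $(X,Y)$ have the common law of the $(X_i,Y_i)$ (the null law). Assume that $\mathcal S_{Y|X}$ exists and equals $\mathrm{span}(\beta_0)$. Assume moreover that, given $X=x$,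 $Y$ has a density $f(\cdot\mid x)$ whose square root is locally absolutely continuous, and that $E[G(B^\top X)^2\,I(X)]<\infty$, where $I(x)=4\int(\partial_y\sqrt{f(y\mid x)})^2\,dy$ is the Fisher information for location. **Estimator.** For $t\in\mathbb R$ let $Z(t)=1\{Y\le t\}$. A dimension reduction method assigns to each $n$, each sample of size $n$ and each $t$ a symmetric $p\times p$ matrix $M_n(t)$, jointly measurable in the sample and $t$. The regularity conditions on the method are imposed under the null law: there are positive semidefinite matrices $M(t)$, measurable in $t$, with $\mathrm{span}\,M(t)=\mathcal S_{Z(t)|X}$ (which exists) for almost every $t$ with respect to the law of $Y$ and $E\|M(Y)\|^2<\infty$, and a measurable matrix function $\psi$ with $E\,\psi(X,Y,t)=0$ for all $t$, $E\|\psi(X,Y,\tilde Y)\|^2<\infty$ for an independent copy $\tilde Y$ of $Y$, and $E\|\psi(X,Y,Y)\|<\infty$, such that for i.i.d. samples from the null law $$M_n(t)=M(t)+\frac1n\sum_{i=1}^n\psi(X_i,Y_i,t)+R_n(t),\qquad \sup_{t\in\mathbb R}\|R_n(t)\|_F=o_p(n^{-1/2}).$$ From a sample with responses $y_1,\dots,y_n$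 put $M_n=n^{-1}\sum_{i=1}^nM_n(y_i)$, let $\hat\lambda_1\ge\dots\ge\hat\lambda_p$ be the eigenvalues of $M_n$ and $\hat\lambda_{p+1}=0$, and let $$\hat q\in\arg\min_{1\le i\le p}\frac{\hat\lambda_{i+1}^2+c}{\hat\lambda_i^2+c},\qquad c=\frac{\log n}{n},$$ with ties broken in any way. **Claim.** If $\hat q$ is computed from the sample $(X_i,Y_{n,i})_{1\le i\le n}$ of $H_{1n}$, then $P(\hat q=1)\to1$ as $n\to\infty$, whatever the value of $q$. -/

import Mathlib

open MeasureTheory ProbabilityTheory Filter Topology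

/-- The covariate space `ℝᵖ` with its Euclidean structure. -/
abbrev Cov (p : ℕ) : Type := EuclideanSpace ℝ (Fin p)

/-! ### Dimension reduction subspaces -/

/-- The σ-algebra on `ℝᵖ × ℝ` generated by the projection of the covariate onto `A`. If `A` is the
column space of a matrix, it is the σ-algebra generated by that matrix transposed times `X`. -/
noncomputable abbrev projSigma {p : ℕ} (A : Submodule ℝ (Cov p)) : MeasurableSpace (Cov p × ℝ) :=
  MeasurableSpace.comap (fun z : Cov p × ℝ => A.starProjection z.1) inferInstance

theorem projSigma_le {p : ℕ} (A : Submodule ℝ (Cov p)) :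
    projSigma A ≤ (inferInstance : MeasurableSpace (Cov p × ℝ)) :=
  Measurable.comap_le (A.starProjection.continuous.measurable.comp measurable_fst)

/-- `A` is a dimension reduction subspace for the response `ζ(X, Y)`, where `(X, Y) ∼ P`: the
response is independent of `X` conditionally on the projection of `X` onto `A`. -/
def IsDRSubspace {p : ℕ} (P : Measure (Cov p × ℝ)) [IsFiniteMeasure P] (ζ : Cov p × ℝ → ℝ)
    (A : Submodule ℝ (Cov p)) : Prop :=
  CondIndepFun (projSigma A) (projSigma_le A) ζ Prod.fst P

/-- `A` is the central subspace of `ζ(X, Y)` given `X`: it is the smallest dimension reduction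
subspace, that is, the intersection of all of them and itself one of them. -/
def IsCentralSubspace {p : ℕ} (P : Measure (Cov p × ℝ)) [IsFiniteMeasure P] (ζ : Cov p × ℝ → ℝ)
    (A : Submodule ℝ (Cov p)) : Prop :=
  IsDRSubspace P ζ A ∧ ∀ A' : Submodule ℝ (Cov p), IsDRSubspace P ζ A' → A ≤ A'

/-- The discretized response `Z(t) = 1{Y ≤ t}`. -/
noncomputable def discretized {p : ℕ} (t : ℝ) (z : Cov p × ℝ) : ℝ :=
  Set.indicator (Set.Iic t) (fun _ => (1 : ℝ)) z.2

/-! ### Discretization-expectation estimation -/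

/-- An estimation method for the kernel matrices `M(t)`: for every sample size `n`, every sample
and every threshold `t`, the estimate `Mₙ(t)`. -/
abbrev KernelEstimator (p : ℕ) : Type :=
  (n : ℕ) → (Fin n → Cov p × ℝ) → ℝ → Matrix (Fin p) (Fin p) ℝ

/-- The estimated target matrix `Mₙ = n⁻¹ ∑ᵢ Mₙ(Yᵢ)`. -/
noncomputable def deeMatrix {p : ℕ} (Mhat : KernelEstimator p) {n : ℕ}
    (s : Fin n → Cov p × ℝ) : Matrix (Fin p) (Fin p) ℝ :=
  (n : ℝ)⁻¹ • ∑ i, Mhat n s (s i).2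

/-- The remainder `Rₙ(t) = Mₙ(t) - M(t) - n⁻¹ ∑ᵢ ψ((Xᵢ, Yᵢ), t)`. -/
noncomputable def kernelRemainder {p : ℕ} (Mhat : KernelEstimator p)
    (M : ℝ → Matrix (Fin p) (Fin p) ℝ) (ψ : Cov p × ℝ → ℝ → Matrix (Fin p) (Fin p) ℝ) {n : ℕ}
    (s : Fin n → Cov p × ℝ) (t : ℝ) : Matrix (Fin p) (Fin p) ℝ :=
  Mhat n s t - M t - (n : ℝ)⁻¹ • ∑ i, ψ (s i) t

/-- The Frobenius norm of a matrix. -/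
noncomputable def frobNorm {p : ℕ} (A : Matrix (Fin p) (Fin p) ℝ) : ℝ :=
  Real.sqrt (∑ i, ∑ j, A i j ^ 2)

/-- The regularity conditions of discretization-expectation estimation, for i.i.d. samples from the
law `P` of `(X, Y)`: `M(t)` spans the central subspace of `Z(t)` given `X`, and the kernel estimate
has an asymptotically linear expansion around `M(t)` with influence function `ψ` and with a
remainder that is `o_p(n^{-1/2})` uniformly in `t`. -/
structure DEERegular {p : ℕ} (P : Measure (Cov p × ℝ)) [IsProbabilityMeasure P]
    (Mhat : KernelEstimator p) (M : ℝ → Matrix (Fin p) (Fin p) ℝ)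
    (ψ : Cov p × ℝ → ℝ → Matrix (Fin p) (Fin p) ℝ) : Prop where
  measurable_estimator : ∀ n i j,
    Measurable (fun z : (Fin n → Cov p × ℝ) × ℝ => Mhat n z.1 z.2 i j)
  symm_estimator : ∀ n s t, (Mhat n s t).IsHermitian
  measurable_kernel : ∀ i j, Measurable (fun t => M t i j)
  posSemidef_kernel : ∀ t, (M t).PosSemidef
  span_kernel : ∀ᵐ t ∂(P.map Prod.snd),
    IsCentralSubspace P (discretized t) (LinearMap.range (Matrix.toEuclideanLin (M t)))
  sq_integrable_kernel : ∀ i j, MemLp (fun z : Cov p × ℝ => M z.2 i j) 2 P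
  measurable_influence : ∀ i j, Measurable (fun z : (Cov p × ℝ) × ℝ => ψ z.1 z.2 i j)
  centered_influence : ∀ t i j, ∫ z, ψ z t i j ∂P = 0
  sq_integrable_influence : ∀ i j,
    MemLp (fun z : (Cov p × ℝ) × ℝ => ψ z.1 z.2 i j) 2 (P.prod (P.map Prod.snd))
  integrable_influence_diag : ∀ i j, Integrable (fun z : Cov p × ℝ => ψ z z.2 i j) P
  remainder : ∀ ε : ℝ, 0 < ε → Tendsto
    (fun n : ℕ => Measure.pi (fun _ : Fin n => P)
      {s | ∃ t : ℝ, ε < Real.sqrt n * frobNorm (kernelRemainder Mhat M ψ s t)})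
    atTop (𝓝 0)

/-! ### The error law -/

/-- For `(X, Y) ∼ P`, the response has a conditional density `f(· | x)` given `X = x` whose square
root is locally absolutely continuous, with derivative `r(x, ·)`, and
`E[γ(X)² I(X)] < ∞` for the Fisher information for location `I(x) = 4 ∫ r(x, y)² dy`. -/
def FiniteLocationInformation {p : ℕ} (P : Measure (Cov p × ℝ)) (γ : Cov p → ℝ) : Prop :=
  ∃ f r : Cov p → ℝ → ℝ,
    Measurable (Function.uncurry f) ∧ Measurable (Function.uncurry r) ∧
    (∀ x y, 0 ≤ f x y) ∧
    P = ((P.map Prod.fst).prod volume).withDensity (fun z => ENNReal.ofReal (f z.1 z.2)) ∧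
    (∀ᵐ x ∂(P.map Prod.fst), ∀ a b : ℝ, IntervalIntegrable (r x) volume a b ∧
      Real.sqrt (f x b) - Real.sqrt (f x a) = ∫ y in a..b, r x y) ∧
    ∫⁻ x, ENNReal.ofReal (γ x ^ 2) * (4 * ∫⁻ y, ENNReal.ofReal (r x y ^ 2))
      ∂(P.map Prod.fst) < ⊤

/-! ### The structural dimension estimate -/

/-- The `i`-th largest eigenvalue of a symmetric matrix, `1 ≤ i ≤ p`, counted with multiplicity;
in particular the value at `i = p + 1` is zero by convention. -/
noncomputable def orderedEigenvalue {p : ℕ} (A : Matrix (Fin p) (Fin p) ℝ) (i : ℕ) : ℝ :=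
  open Classical in
  if h : A.IsHermitian ∧ 1 ≤ i ∧ i ≤ p then
    h.1.eigenvalues₀ ⟨i - 1, by rw [Fintype.card_fin]; omega⟩
  else 0

/-- The ridge-type eigenvalue ratio `(λ_{i+1}² + c) / (λ_i² + c)`. -/
noncomputable def ridgeRatio {p : ℕ} (A : Matrix (Fin p) (Fin p) ℝ) (c : ℝ) (i : ℕ) : ℝ :=
  (orderedEigenvalue A (i + 1) ^ 2 + c) / (orderedEigenvalue A i ^ 2 + c)

/-- `k` is a minimum ridge-type eigenvalue ratio estimate computed from the matrix `A`: it minimizes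
the ridge-type ratio over `{1, …, p}`. -/
def IsRidgeRatioEstimate {p : ℕ} (A : Matrix (Fin p) (Fin p) ℝ) (c : ℝ) (k : ℕ) : Prop :=
  k ∈ Finset.Icc 1 p ∧ ∀ i ∈ Finset.Icc 1 p, ridgeRatio A c k ≤ ridgeRatio A c i

/-! ### The regression model -/

/-- The response `g(β₀ᵀx, θ₀) + C G(Bᵀx) + e`; `C = 0` is the null model. -/
noncomputable def response {p d q : ℕ} (g : ℝ → EuclideanSpace ℝ (Fin d) → ℝ) (β₀ : Cov p)
    (θ₀ : EuclideanSpace ℝ (Fin d)) (G : EuclideanSpace ℝ (Fin q) → ℝ)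
    (B : Matrix (Fin p) (Fin q) ℝ) (C : ℝ) (x : Cov p) (e : ℝ) : ℝ :=
  g (inner ℝ β₀ x) θ₀ + C * G (Matrix.toEuclideanLin B.transpose x) + e

/-! The estimator is analysed only under the null law; the conclusion is carried to the alternatives
by contiguity.

Under the null, `Z(t)` is a function of `Y`, so its central subspace lies in `span β₀` and `E M(Y) =
κ β₀ β₀ᵀ`. Here `κ > 0`: otherwise almost every `Z(t)` would be independent of `X`, hence so would
`Y`, and the central subspace would be trivial (`DEERegular.exists_integral_kernel`). The error of
`Mₙ` is a sample mean, a V-statistic in `ψ` and a uniform remainder, all of order `n^{-1/2}`, so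
each entry is within `√(log n / n) = √c` of its target with probability tending to one
(`DEERegular.tendsto_measure_entry_deviation`).

The alternative shifts the response by `γ(X)/√n` with `γ(x) = G(Bᵀx)`. Finite location information
makes the root density differentiable in quadratic mean along this shift, so events of vanishing
probability under the null product law keep vanishing probability under the alternative
(`tendsto_pi_of_quadratic_mean`, `FiniteLocationInformation.tendsto_pi_map_shift`). No likelihood
expansion is needed: the second moment of a truncated likelihood ratio stays bounded, and
Cauchy–Schwarz does the rest.

On the remaining event the top eigenvalue is bounded below and the others are `O(√c)`. The ridge
ratio is then `O(c)` at position 1 and bounded below at every other position, whatever `q` is. -/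

/-! ### Perturbation of rank-one matrices and the ridge ratio -/

/-- The factor `p` is the Cauchy–Schwarz loss in `(∑ |vᵢ|)² ≤ p ‖v‖²`; passing to quadratic forms
lets eigenvalues be compared variationally. -/
theorem abs_inner_toEuclideanLin_sub_le {p : ℕ} {A : Matrix (Fin p) (Fin p) ℝ} {κ δ : ℝ}
    {b : Cov p} (h : ∀ i j, |A i j - κ * (b i * b j)| ≤ δ) (v : Cov p) :
    |inner ℝ v (Matrix.toEuclideanLin A v) - κ * (inner ℝ b v) ^ 2| ≤ (p * δ) * ‖v‖ ^ 2 := by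
  have e1 : inner ℝ v (Matrix.toEuclideanLin A v) = ∑ i, ∑ j, A i j * (v i * v j) := by
    simp only [PiLp.inner_apply, Matrix.toLpLin_apply, Matrix.mulVec, dotProduct,
      RCLike.inner_apply, conj_trivial, Finset.sum_mul]
    exact Finset.sum_congr rfl fun i _ => Finset.sum_congr rfl fun j _ => by ring
  have e2 : (inner ℝ b v) ^ 2 = ∑ i, ∑ j, (b i * b j) * (v i * v j) := by
    simp only [PiLp.inner_apply, RCLike.inner_apply, conj_trivial]
    rw [sq, Finset.sum_mul_sum]
    exact Finset.sum_congr rfl fun i _ => Finset.sum_congr rfl fun j _ => by ring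
  have hδ : 0 ≤ p * δ := by
    rcases Nat.eq_zero_or_pos p with rfl | hp
    · simp
    · have := (abs_nonneg _).trans (h ⟨0, hp⟩ ⟨0, hp⟩)
      positivity
  have e3 : inner ℝ v (Matrix.toEuclideanLin A v) - κ * (inner ℝ b v) ^ 2
      = ∑ i, ∑ j, (A i j - κ * (b i * b j)) * (v i * v j) := by
    rw [e1, e2, Finset.mul_sum, ← Finset.sum_sub_distrib]
    refine Finset.sum_congr rfl fun i _ => ?_
    rw [Finset.mul_sum, ← Finset.sum_sub_distrib]
    exact Finset.sum_congr rfl fun j _ => by ring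
  rw [e3]
  calc |∑ i, ∑ j, (A i j - κ * (b i * b j)) * (v i * v j)|
      ≤ ∑ i, ∑ j, δ * (|v i| * |v j|) := by
        refine (Finset.abs_sum_le_sum_abs _ _).trans (Finset.sum_le_sum fun i _ => ?_)
        refine (Finset.abs_sum_le_sum_abs _ _).trans (Finset.sum_le_sum fun j _ => ?_)
        rw [abs_mul, abs_mul (v i)]
        exact mul_le_mul_of_nonneg_right (h i j) (by positivity)
    _ = δ * (∑ i, |v i|) ^ 2 := by
        rw [sq, Finset.sum_mul_sum, Finset.mul_sum]
        simp only [Finset.mul_sum]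
    _ ≤ (p * δ) * ‖v‖ ^ 2 := by
        have hcs : (∑ i, |v i|) ^ 2 ≤ p * ‖v‖ ^ 2 := by
          have := sq_sum_le_card_mul_sum_sq (s := Finset.univ) (f := fun i => |v i|)
          simpa [EuclideanSpace.norm_sq_eq] using this
        rcases Nat.eq_zero_or_pos p with rfl | hp
        · simp
        · have h0 := (abs_nonneg _).trans (h ⟨0, hp⟩ ⟨0, hp⟩)
          calc δ * (∑ i, |v i|) ^ 2 ≤ δ * (p * ‖v‖ ^ 2) := by gcongr
            _ = _ := by ring

/-- Eigenvalues of a perturbation of a positive semidefinite matrix of rank one. -/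
theorem orderedEigenvalue_near_rank_one {p : ℕ} {A : Matrix (Fin p) (Fin p) ℝ}
    (hA : A.IsHermitian) {κ δ : ℝ} (hκ : 0 ≤ κ) (hδ : 0 ≤ δ) {b : Cov p}
    (h : ∀ v : Cov p,
      |inner ℝ v (Matrix.toEuclideanLin A v) - κ * (inner ℝ b v) ^ 2| ≤ δ * ‖v‖ ^ 2) :
    (∀ i, 2 ≤ i → |orderedEigenvalue A i| ≤ δ) ∧
      (b ≠ 0 → κ * ‖b‖ ^ 2 - δ ≤ orderedEigenvalue A 1) := by
  -- `eigenvalues₀` is sorted while the eigenbasis is indexed by `Fin p`; `e` is the reindexing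
  -- inside `IsHermitian.eigenvalues`, so `u k` belongs to the eigenvalue at sorted position `k`.
  set e : Fin (Fintype.card (Fin p)) ≃ Fin p := Fintype.equivOfCardEq (Fintype.card_fin _)
  set u : Fin (Fintype.card (Fin p)) → Cov p := fun k => hA.eigenvectorBasis (e k)
  have hAu : ∀ k, Matrix.toEuclideanLin A (u k) = hA.eigenvalues₀ k • u k := by
    intro k
    have h1 := hA.mulVec_eigenvectorBasis (e k)
    have h2 : hA.eigenvalues (e k) = hA.eigenvalues₀ k := by
      simp [Matrix.IsHermitian.eigenvalues, e]
    rw [h2] at h1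
    rw [Matrix.toLpLin_apply]
    apply (WithLp.ofLp_injective 2)
    simpa using h1
  have hin : ∀ k l, inner ℝ (u k) (u l) = if k = l then (1 : ℝ) else 0 := by
    intro k l
    have := orthonormal_iff_ite.1 hA.eigenvectorBasis.orthonormal (e k) (e l)
    simpa [u] using this
  have hun : ∀ k, ‖u k‖ = 1 := fun k => hA.eigenvectorBasis.orthonormal.1 (e k)
  constructor
  · intro i hi
    by_cases hip : i ≤ p
    · have hO : orderedEigenvalue A i = hA.eigenvalues₀ ⟨i - 1, by rw [Fintype.card_fin]; omega⟩ := by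
        unfold orderedEigenvalue
        rw [dif_pos ⟨hA, by omega, hip⟩]
      set k : Fin (Fintype.card (Fin p)) := ⟨i - 1, by rw [Fintype.card_fin]; omega⟩
      set z : Fin (Fintype.card (Fin p)) := ⟨0, by rw [Fintype.card_fin]; omega⟩
      have hzk : z ≠ k := by simp [z, k, Fin.ext_iff]; omega
      have hle : hA.eigenvalues₀ k ≤ hA.eigenvalues₀ z :=
        hA.eigenvalues₀_antitone (by simp [z, k, Fin.le_def])
      rw [hO, abs_le]
      constructor
      · have := (abs_le.1 (h (u k))).1
        rw [hAu, inner_smul_right, hin, if_pos rfl, hun] at this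
        nlinarith [mul_nonneg hκ (sq_nonneg (inner ℝ b (u k)))]
      · set α := inner ℝ b (u k)
        set β := inner ℝ b (u z)
        by_cases hαβ : α = 0
        · have := (abs_le.1 (h (u k))).2
          rw [hAu, inner_smul_right, hin, if_pos rfl, hun, show inner ℝ b (u k) = 0 from hαβ] at this
          linarith
        -- Courant–Fischer by hand: the plane of `u z` and `u k` contains a nonzero vector
        -- orthogonal to `b`. There the rank-one part vanishes, so the form is at most `δ ‖·‖²`, yet
        -- it is at least `λ_k ‖·‖²`.
        · have hb : inner ℝ b (α • u z - β • u k) = 0 := by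
            rw [inner_sub_right, inner_smul_right, inner_smul_right]
            ring
          have hn : ‖α • u z - β • u k‖ ^ 2 = α ^ 2 + β ^ 2 := by
            rw [← real_inner_self_eq_norm_sq]
            simp only [inner_sub_right, inner_sub_left, inner_smul_right, inner_smul_left, hin,
              hzk, hzk.symm, if_true, if_false, conj_trivial]
            ring
          have hq : inner ℝ (α • u z - β • u k) (Matrix.toEuclideanLin A (α • u z - β • u k))
              = hA.eigenvalues₀ z * α ^ 2 + hA.eigenvalues₀ k * β ^ 2 := by
            rw [map_sub, map_smul, map_smul, hAu, hAu]
            simp only [inner_sub_right, inner_sub_left, inner_smul_right, inner_smul_left, hin,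
              hzk, hzk.symm, if_true, if_false, conj_trivial]
            ring
          have := (abs_le.1 (h (α • u z - β • u k))).2
          rw [hb, hn, hq] at this
          have hpos : 0 < α ^ 2 + β ^ 2 := by positivity
          have h3 : hA.eigenvalues₀ k * (α ^ 2 + β ^ 2) ≤ δ * (α ^ 2 + β ^ 2) := by
            nlinarith [mul_le_mul_of_nonneg_right hle (sq_nonneg α)]
          exact le_of_mul_le_mul_right h3 hpos
    · have hO : orderedEigenvalue A i = 0 := by
        unfold orderedEigenvalue
        rw [dif_neg fun hh => hip hh.2.2]
      simpa [hO] using hδ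
  · intro hb
    have hp : 1 ≤ p := by
      rcases Nat.eq_zero_or_pos p with rfl | hp
      · exact absurd (Subsingleton.elim _ _) hb
      · exact hp
    have hO : orderedEigenvalue A 1 = hA.eigenvalues₀ ⟨0, by rw [Fintype.card_fin]; omega⟩ := by
      unfold orderedEigenvalue
      rw [dif_pos ⟨hA, le_rfl, hp⟩]
    set z : Fin (Fintype.card (Fin p)) := ⟨0, by rw [Fintype.card_fin]; omega⟩
    have h1 := (abs_le.1 (h b)).1
    rw [real_inner_self_eq_norm_sq] at h1
    have hsa : ∀ k, inner ℝ (hA.eigenvectorBasis k) (Matrix.toEuclideanLin A b)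
        = hA.eigenvalues₀ (e.symm k) * inner ℝ (hA.eigenvectorBasis k) b := by
      intro k
      have hs : (Matrix.toEuclideanLin A).IsSymmetric := Matrix.isSymmetric_toEuclideanLin_iff.2 hA
      rw [← hs]
      have := hAu (e.symm k)
      simp only [u, Equiv.apply_symm_apply] at this
      rw [this, inner_smul_left]
      simp
    -- Rayleigh bound: the form at `b` is at most the largest eigenvalue times `‖b‖²`, while by
    -- hypothesis it is at least `κ ‖b‖⁴ - δ ‖b‖²`.
    have h2 : inner ℝ b (Matrix.toEuclideanLin A b) ≤ hA.eigenvalues₀ z * ‖b‖ ^ 2 := by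
      rw [← hA.eigenvectorBasis.sum_inner_mul_inner b (Matrix.toEuclideanLin A b),
        ← hA.eigenvectorBasis.sum_sq_norm_inner_right b, Finset.mul_sum]
      refine Finset.sum_le_sum fun k _ => ?_
      rw [hsa, real_inner_comm, Real.norm_eq_abs, sq_abs]
      have : hA.eigenvalues₀ (e.symm k) ≤ hA.eigenvalues₀ z :=
        hA.eigenvalues₀_antitone (by simp [z, Fin.le_def])
      nlinarith [mul_le_mul_of_nonneg_right this (sq_nonneg (inner ℝ (hA.eigenvectorBasis k) b))]
    rw [hO]
    have hbp : 0 < ‖b‖ ^ 2 := by positivity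
    refine le_of_mul_le_mul_right (a := ‖b‖ ^ 2) ?_ hbp
    nlinarith

/-- If the largest eigenvalue is bounded below and the other squared eigenvalues are of the order
of the ridge, the ridge ratio is smallest at the first position. -/
theorem IsRidgeRatioEstimate.eq_one {p : ℕ} {A : Matrix (Fin p) (Fin p) ℝ} {c K m : ℝ} {k : ℕ}
    (hk : IsRidgeRatioEstimate A c k) (hc : 0 < c) (hK : 0 ≤ K) (hm : 0 ≤ m)
    (hsmall : ∀ i, 2 ≤ i → orderedEigenvalue A i ^ 2 ≤ K * c)
    (hlarge : m ≤ orderedEigenvalue A 1) (hcm : c * (K + 1) ^ 2 ≤ m ^ 2) : k = 1 := by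
  by_contra hne
  have hk1 := Finset.mem_Icc.1 hk.1
  have hr := hk.2 1 (Finset.mem_Icc.2 ⟨le_rfl, by omega⟩)
  unfold ridgeRatio at hr
  have h1 := hsmall 2 le_rfl
  have h2 := hsmall k (by omega)
  have h3 : m ^ 2 ≤ orderedEigenvalue A 1 ^ 2 := by gcongr
  rw [div_le_div_iff₀ (by positivity) (by positivity)] at hr
  -- For `k ≥ 2` the ratio at `k` is at least `1 / (K + 1)`, while the ratio at 1 is at most `(K +
  -- 1) c / (m² + c)`. Minimality would give `c (m² + c) ≤ c² (K + 1)² ≤ c m²`, which is absurd.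
  have h4 : c * (m ^ 2 + c)
      ≤ (orderedEigenvalue A (k + 1) ^ 2 + c) * (orderedEigenvalue A 1 ^ 2 + c) := by
    gcongr
    nlinarith [sq_nonneg (orderedEigenvalue A (k + 1))]
  have h5 : (orderedEigenvalue A (1 + 1) ^ 2 + c) * (orderedEigenvalue A k ^ 2 + c)
      ≤ (K * c + c) * (K * c + c) := by
    gcongr
  have h6 := mul_le_mul_of_nonneg_left hcm hc.le
  nlinarith [mul_pos hc hc]

/-! ### Central subspaces and the mean kernel matrix -/

/-- Every column is a multiple `c j • b`; symmetry forces `c` to be proportional to `b`, and the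
trace identifies the factor. -/
theorem Matrix.IsHermitian.eq_trace_smul_of_range_le_span {p : ℕ} {A : Matrix (Fin p) (Fin p) ℝ}
    (hA : A.IsHermitian) {b : Cov p} (hb : b ≠ 0)
    (h : LinearMap.range (Matrix.toEuclideanLin A) ≤ Submodule.span ℝ {b}) (i j : Fin p) :
    A i j = A.trace / ‖b‖ ^ 2 * (b i * b j) := by
  have hc : ∀ j, ∃ c : ℝ, ∀ i, A i j = c * b i := by
    intro j
    obtain ⟨c, hc⟩ := Submodule.mem_span_singleton.1
      (h (LinearMap.mem_range_self _ (EuclideanSpace.single j (1 : ℝ))))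
    refine ⟨c, fun i => ?_⟩
    have := congrArg (fun v : Cov p => v i) hc
    simpa [Matrix.toLpLin_apply] using this.symm
  choose c hc using hc
  have hs : ∀ i j, c j * b i = c i * b j := by
    intro i j
    rw [← hc, ← hc]
    simpa using (hA.apply i j).symm
  have hn : ‖b‖ ^ 2 = ∑ k, b k * b k := by
    simp [EuclideanSpace.norm_sq_eq, ← sq]
  have hpos : ‖b‖ ^ 2 ≠ 0 := by positivity
  have ht : A.trace = ∑ k, c k * b k := Finset.sum_congr rfl fun k _ => by simp [hc]
  rw [hc, div_mul_eq_mul_div, eq_div_iff hpos, hn, ht, Finset.mul_sum, Finset.sum_mul]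
  refine Finset.sum_congr rfl fun k _ => ?_
  linear_combination (b i * b k) * hs k j

/-- Conditional probabilities given the trivial σ-algebra are constants. The equation `m = ⊥` is a
hypothesis because `projSigma ⊥` is trivial only up to a proved equality. -/
theorem condIndepFun_bot_iff {Ω β β' : Type*} {m mΩ : MeasurableSpace Ω} [StandardBorelSpace Ω]
    {mβ : MeasurableSpace β} {mβ' : MeasurableSpace β'} {μ : Measure Ω} [IsProbabilityMeasure μ]
    (hm : m ≤ mΩ) (hbot : m = ⊥) {f : Ω → β} {g : Ω → β'}
    (hf : Measurable f) (hg : Measurable g) :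
    CondIndepFun m hm f g μ ↔ IndepFun f g μ := by
  subst hbot
  have key : ∀ s, MeasurableSet s → μ⟦s | ⊥⟧ = fun _ => μ.real s := by
    intro s hs
    rw [condExp_bot, integral_indicator_const _ hs]
    simp
  rw [condIndepFun_iff_condExp_inter_preimage_eq_mul hf hg,
    indepFun_iff_measure_inter_preimage_eq_mul]
  refine forall₄_congr fun s t hs ht => ?_
  rw [key _ (hf hs), key _ (hg ht), key _ ((hf hs).inter (hg ht))]
  constructor
  · intro h
    obtain ⟨x, hx⟩ := h.exists
    rw [← ENNReal.toReal_eq_toReal_iff' (measure_ne_top _ _)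
      (ENNReal.mul_ne_top (measure_ne_top _ _) (measure_ne_top _ _)), ENNReal.toReal_mul]
    exact hx
  · intro h
    refine Filter.Eventually.of_forall fun x => ?_
    simp [Measure.real, h]

theorem projSigma_bot {p : ℕ} : projSigma (⊥ : Submodule ℝ (Cov p)) = ⊥ := by
  simp [projSigma, MeasurableSpace.comap_const]

theorem measurable_discretized {p : ℕ} (t : ℝ) : Measurable (discretized (p := p) t) :=
  (measurable_const.indicator measurableSet_Iic).comp measurable_snd

theorem isDRSubspace_bot_iff {p : ℕ} {P : Measure (Cov p × ℝ)} [IsProbabilityMeasure P]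
    {ζ : Cov p × ℝ → ℝ} (hζ : Measurable ζ) :
    IsDRSubspace P ζ ⊥ ↔ IndepFun ζ Prod.fst P :=
  condIndepFun_bot_iff _ projSigma_bot hζ measurable_fst

theorem IsDRSubspace.discretized {p : ℕ} {P : Measure (Cov p × ℝ)} [IsProbabilityMeasure P]
    {A : Submodule ℝ (Cov p)} (h : IsDRSubspace P Prod.snd A) (t : ℝ) :
    IsDRSubspace P (discretized t) A :=
  CondIndepFun.comp (φ := Set.indicator (Set.Iic t) fun _ => (1 : ℝ)) (ψ := id) h
    (measurable_const.indicator measurableSet_Iic) measurable_id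

/-- If the law of the response has no atoms, independence of almost all discretized responses
implies independence of the response. -/
theorem indepFun_snd_of_ae_discretized {p : ℕ} {P : Measure (Cov p × ℝ)} [IsProbabilityMeasure P]
    [NullSingletonClass (P.map Prod.snd)]
    (h : ∀ᵐ t ∂(P.map Prod.snd), IndepFun (discretized t) Prod.fst P) :
    IndepFun Prod.snd Prod.fst P := by
  have hset : ∀ t, IndepFun (discretized t) Prod.fst P → ∀ S : Set (Cov p), MeasurableSet S →
      P (Prod.snd ⁻¹' Set.Iic t ∩ Prod.fst ⁻¹' S)
        = P (Prod.snd ⁻¹' Set.Iic t) * P (Prod.fst ⁻¹' S) := by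
    intro t ht S hS
    have := ht.measure_inter_preimage_eq_mul {1} S (measurableSet_singleton _) hS
    have e : discretized t ⁻¹' {(1 : ℝ)} = (Prod.snd ⁻¹' Set.Iic t : Set (Cov p × ℝ)) := by
      ext z
      by_cases hz : z.2 ≤ t <;> simp [_root_.discretized, hz]
    rwa [e] at this
  have hall : ∀ t (S : Set (Cov p)), MeasurableSet S →
      P (Prod.snd ⁻¹' Set.Iic t ∩ Prod.fst ⁻¹' S)
        = P (Prod.snd ⁻¹' Set.Iic t) * P (Prod.fst ⁻¹' S) := by
    intro t S hS
    -- An arbitrary `t` is reached from below by good thresholds increasing to `sSup (T ∩ Iic t)`.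
    -- What `Iic t` contains beyond them lies in `Tᶜ` or is that supremum itself, a null set since
    -- there are no atoms.
    set T := {t | IndepFun (discretized t) Prod.fst P}
    have hT : P.map Prod.snd Tᶜ = 0 := h
    rcases Set.eq_empty_or_nonempty (T ∩ Set.Iic t) with hU | hU
    · have h0 : P (Prod.snd ⁻¹' Set.Iic t) = 0 := by
        rw [← Measure.map_apply measurable_snd measurableSet_Iic]
        refine measure_mono_null (t := Tᶜ) (fun s hs hsT => ?_) hT
        exact Set.notMem_empty s (hU ▸ ⟨hsT, hs⟩)
      rw [h0, zero_mul]
      exact measure_mono_null Set.inter_subset_left h0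
    · have hbdd : BddAbove (T ∩ Set.Iic t) := ⟨t, fun s hs => hs.2⟩
      obtain ⟨u, hum, hut, huT⟩ := exists_seq_tendsto_sSup hU hbdd
      set V : Set ℝ := ⋃ k, Set.Iic (u k)
      have hVsub : V ⊆ Set.Iic t := Set.iUnion_subset fun k => Set.Iic_subset_Iic.2 (huT k).2
      have hdiff : P.map Prod.snd (Set.Iic t \ V) = 0 := by
        refine measure_mono_null (t := Tᶜ ∪ {sSup (T ∩ Set.Iic t)}) (fun s hs => ?_)
          (measure_union_null hT (measure_singleton _))
        by_cases hsT : s ∈ T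
        · right
          refine le_antisymm (le_csSup hbdd ⟨hsT, hs.1⟩) ?_
          refine le_of_tendsto' hut fun k => ?_
          by_contra hlt
          exact hs.2 (Set.mem_iUnion.2 ⟨k, (not_le.1 hlt).le⟩)
        · exact Or.inl hsT
      have hVm : MeasurableSet V := MeasurableSet.iUnion fun k => measurableSet_Iic
      have hpre : P (Prod.snd ⁻¹' (Set.Iic t \ V)) = 0 := by
        rwa [← Measure.map_apply measurable_snd (measurableSet_Iic.diff hVm)]
      have hae : (Prod.snd ⁻¹' V : Set (Cov p × ℝ)) =ᵐ[P] Prod.snd ⁻¹' Set.Iic t :=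
        (LE.le.eventuallyLE (Set.preimage_mono hVsub)).antisymm
          (ae_le_set.2 (by rwa [← Set.preimage_sdiff]))
      have hmono : Monotone fun k => (Prod.snd ⁻¹' Set.Iic (u k) : Set (Cov p × ℝ)) :=
        fun k l hkl => Set.preimage_mono (Set.Iic_subset_Iic.2 (hum hkl))
      have l1 := tendsto_measure_iUnion_atTop (μ := P) hmono
      have l2 := tendsto_measure_iUnion_atTop (μ := P)
        (s := fun k => (Prod.snd ⁻¹' Set.Iic (u k) ∩ Prod.fst ⁻¹' S : Set (Cov p × ℝ)))
        (fun k l hkl => Set.inter_subset_inter_left _ (hmono hkl))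
      rw [← Set.iUnion_inter] at l2
      rw [← Set.preimage_iUnion] at l1 l2
      rw [measure_congr hae] at l1
      rw [measure_congr (hae.inter (ae_eq_refl (Prod.fst ⁻¹' S)))] at l2
      refine tendsto_nhds_unique l2 ?_
      have l3 := ENNReal.Tendsto.mul_const (b := P (Prod.fst ⁻¹' S)) l1
        (Or.inr (measure_ne_top _ _))
      refine l3.congr fun k => ?_
      exact (hset _ (huT k).1 S hS).symm
  rw [IndepFun_iff_Indep]
  refine IndepSets.indep (p1 := Set.preimage Prod.snd '' Set.range Set.Iic)
    (p2 := {A | MeasurableSet[MeasurableSpace.comap Prod.fst inferInstance] A})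
    measurable_snd.comap_le measurable_fst.comap_le
    ?_ (@MeasurableSpace.isPiSystem_measurableSet _ (MeasurableSpace.comap Prod.fst inferInstance))
    ?_ (@MeasurableSpace.generateFrom_measurableSet _ (MeasurableSpace.comap Prod.fst inferInstance)).symm
    ?_
  · rintro _ ⟨_, ⟨s, rfl⟩, rfl⟩ _ ⟨_, ⟨t, rfl⟩, rfl⟩ -
    exact ⟨Set.Iic (s ⊓ t), ⟨_, rfl⟩, by rw [← Set.preimage_inter, Set.Iic_inter_Iic]⟩
  · rw [← MeasurableSpace.comap_generateFrom, ← borel_eq_generateFrom_Iic,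
      ← BorelSpace.measurable_eq]
  · rw [IndepSets_iff]
    rintro _ _ ⟨_, ⟨t, rfl⟩, rfl⟩ ⟨S, hS, rfl⟩
    exact hall t S hS

/-- The mean kernel matrix is a positive multiple of the projection on the central subspace. -/
theorem DEERegular.exists_integral_kernel {p : ℕ} {P : Measure (Cov p × ℝ)}
    [IsProbabilityMeasure P] [NullSingletonClass (P.map Prod.snd)] {Mhat : KernelEstimator p}
    {M : ℝ → Matrix (Fin p) (Fin p) ℝ} {ψ : Cov p × ℝ → ℝ → Matrix (Fin p) (Fin p) ℝ}
    (hreg : DEERegular P Mhat M ψ) {b : Cov p} (hb : b ≠ 0)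
    (hcentral : IsCentralSubspace P Prod.snd (Submodule.span ℝ {b})) :
    ∃ κ : ℝ, 0 < κ ∧ ∀ i j, ∫ z, M z.2 i j ∂P = κ * (b i * b j) := by
  -- `span {b}` is a dimension reduction subspace for `Y`, hence for `Z(t)`, so it contains the
  -- range of `M t`.
  have hM' : ∀ᵐ t ∂(P.map Prod.snd), ∀ i j, M t i j = (M t).trace / ‖b‖ ^ 2 * (b i * b j) := by
    filter_upwards [hreg.span_kernel] with t ht i j
    exact Matrix.IsHermitian.eq_trace_smul_of_range_le_span (hreg.posSemidef_kernel _).1 hb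
      (ht.2 _ (hcentral.1.discretized _)) i j
  have hM : ∀ᵐ z ∂P, ∀ i j, M z.2 i j = (M z.2).trace / ‖b‖ ^ 2 * (b i * b j) :=
    ae_of_ae_map measurable_snd.aemeasurable hM'
  have hint : ∀ i j, Integrable (fun z : Cov p × ℝ => M z.2 i j) P := fun i j =>
    (hreg.sq_integrable_kernel i j).integrable (by norm_num)
  have htr : Integrable (fun z : Cov p × ℝ => (M z.2).trace) P :=
    integrable_finsetSum _ fun i _ => hint i i
  have hpos : 0 < ‖b‖ ^ 2 := by positivity
  have hnn : ∀ z : Cov p × ℝ, 0 ≤ (M z.2).trace := fun z => (hreg.posSemidef_kernel _).trace_nonneg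
  refine ⟨(∫ z, (M z.2).trace ∂P) / ‖b‖ ^ 2, ?_, fun i j => ?_⟩
  -- A zero mean trace makes `M t` vanish for almost every `t`; then `⊥` is the central subspace of
  -- almost every `Z(t)`, hence of `Y`, contradicting `b ≠ 0`.
  · refine div_pos (lt_of_le_of_ne (integral_nonneg hnn) fun h0 => ?_) hpos
    have hz := (integral_eq_zero_iff_of_nonneg hnn htr).1 h0.symm
    have hmtr : Measurable fun t => (M t).trace :=
      Finset.measurable_sum _ fun i _ => hreg.measurable_kernel i i
    have hz' : ∀ᵐ t ∂(P.map Prod.snd), (M t).trace = 0 :=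
      (ae_map_iff measurable_snd.aemeasurable (hmtr (measurableSet_singleton 0))).2 hz
    have hind' : ∀ᵐ t ∂(P.map Prod.snd), IndepFun (discretized t) Prod.fst P := by
      filter_upwards [hreg.span_kernel, hM', hz'] with t h1 h2 h3
      have hM0 : M t = 0 := by
        ext i j
        rw [h2, h3]
        simp
      have := h1.1
      rw [hM0, map_zero, LinearMap.range_zero] at this
      exact (isDRSubspace_bot_iff (measurable_discretized _)).1 this
    have hbot := hcentral.2 ⊥
      ((isDRSubspace_bot_iff measurable_snd).2 (indepFun_snd_of_ae_discretized hind'))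
    exact hb (by simpa using hbot)
  · rw [integral_congr_ae (hM.mono fun z hz => hz i j), integral_mul_const, integral_div]

/-! ### Contiguity of product measures -/

theorem lintegral_pi_prod_eq_pow {E : Type*} [MeasurableSpace E] (P : Measure E)
    [IsProbabilityMeasure P] {n : ℕ} {L : E → ENNReal} (hL : Measurable L) :
    ∫⁻ z, ∏ i, L (z i) ∂(Measure.pi fun _ : Fin n => P) = (∫⁻ x, L x ∂P) ^ n := by
  have hi : iIndepFun (fun (i : Fin n) (z : Fin n → E) => L (z i)) (Measure.pi fun _ : Fin n => P) :=
    iIndepFun_pi (X := fun (_ : Fin n) => L) fun _ => hL.aemeasurable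
  rw [lintegral_prod_eq_prod_lintegral_of_indepFun _ _ hi fun i => hL.comp (measurable_pi_apply i)]
  have : ∀ i : Fin n, ∫⁻ z, L (z i) ∂(Measure.pi fun _ : Fin n => P) = ∫⁻ x, L x ∂P := fun i =>
    (measurePreserving_eval (fun _ : Fin n => P) i).lintegral_comp hL
  simp [this]

theorem pi_withDensity_eq {E : Type*} [MeasurableSpace E] (P : Measure E)
    [IsProbabilityMeasure P] {n : ℕ} {L : E → ENNReal} (hL : Measurable L)
    [SigmaFinite (P.withDensity L)] :
    (Measure.pi fun _ : Fin n => P.withDensity L)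
      = (Measure.pi fun _ : Fin n => P).withDensity fun z => ∏ i, L (z i) := by
  refine Measure.pi_eq fun s hs => ?_
  rw [withDensity_apply _ (MeasurableSet.univ_pi hs), ← lintegral_indicator (MeasurableSet.univ_pi hs)]
  have e : ∀ z : Fin n → E, (Set.univ.pi s).indicator (fun z => ∏ i, L (z i)) z
      = ∏ i, (s i).indicator L (z i) := by
    intro z
    by_cases hz : z ∈ Set.univ.pi s
    · rw [Set.indicator_of_mem hz]
      exact Finset.prod_congr rfl fun i _ => (Set.indicator_of_mem (hz i trivial) _).symm
    · rw [Set.indicator_of_notMem hz]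
      simp only [Set.mem_pi, Set.mem_univ, true_implies, not_forall] at hz
      obtain ⟨i, hi⟩ := hz
      exact (Finset.prod_eq_zero (Finset.mem_univ i) (Set.indicator_of_notMem hi _)).symm
  simp_rw [e]
  have hm : ∀ i, Measurable ((s i).indicator L) := fun i => hL.indicator (hs i)
  have hi : iIndepFun (fun (i : Fin n) (z : Fin n → E) => (s i).indicator L (z i))
      (Measure.pi fun _ : Fin n => P) :=
    iIndepFun_pi (X := fun (i : Fin n) => (s i).indicator L) fun i => (hm i).aemeasurable
  rw [lintegral_prod_eq_prod_lintegral_of_indepFun _ _ hi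
    fun i => (hm i).comp (measurable_pi_apply i)]
  refine Finset.prod_congr rfl fun i _ => ?_
  rw [(measurePreserving_eval (fun _ : Fin n => P) i).lintegral_comp (hm i),
    lintegral_indicator (hs i), withDensity_apply _ (hs i)]

/-- A bound for product measures when the likelihood ratio is controlled on a large set. -/
theorem measure_pi_le_of_restrict_eq_withDensity {E : Type*} [MeasurableSpace E] (P Q : Measure E)
    [IsProbabilityMeasure P] [IsProbabilityMeasure Q] {n : ℕ} {L : E → ENNReal} (hL : Measurable L)
    {A : Set E} (hA : MeasurableSet A) (hQ : Q.restrict A = P.withDensity L)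
    {S : Set (Fin n → E)} (hS : MeasurableSet S) :
    Measure.pi (fun _ : Fin n => Q) S ≤ n * Q Aᶜ
      + (Measure.pi (fun _ : Fin n => P) S) ^ (1 / 2 : ℝ)
        * ((∫⁻ x, L x ^ 2 ∂P) ^ n) ^ (1 / 2 : ℝ) := by
  set An : Set (Fin n → E) := Set.univ.pi fun _ => A
  have hAn : MeasurableSet An := MeasurableSet.univ_pi fun _ => hA
  have hsub : S ⊆ Anᶜ ∪ (S ∩ An) := fun z hz => by
    by_cases h : z ∈ An
    · exact Or.inr ⟨hz, h⟩
    · exact Or.inl h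
  -- A union bound handles samples leaving `A`. Inside `Aⁿ` the density is `∏ L`, and Cauchy–Schwarz
  -- separates it from the indicator of `S`.
  refine (measure_mono hsub).trans ((measure_union_le _ _).trans (add_le_add ?_ ?_))
  · have hc : Anᶜ ⊆ ⋃ i : Fin n, Function.eval i ⁻¹' Aᶜ := by
      intro z hz
      simp only [An, Set.mem_compl_iff, Set.mem_pi, Set.mem_univ, true_implies, not_forall] at hz
      exact Set.mem_iUnion.2 hz
    refine (measure_mono hc).trans ((measure_iUnion_fintype_le _ _).trans_eq ?_)
    have : ∀ i : Fin n, Measure.pi (fun _ : Fin n => Q) (Function.eval i ⁻¹' Aᶜ) = Q Aᶜ := fun i =>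
      (measurePreserving_eval (fun _ : Fin n => Q) i).measure_preimage hA.compl.nullMeasurableSet
    rw [Finset.sum_congr rfl fun i _ => this i]
    simp
  · have : IsFiniteMeasure (P.withDensity L) := hQ ▸ inferInstance
    rw [← Measure.restrict_apply hS, Measure.restrict_pi_pi, hQ, pi_withDensity_eq P hL,
      withDensity_apply _ hS, ← lintegral_indicator hS]
    have hprod : Measurable fun z : Fin n → E => ∏ i, L (z i) :=
      Finset.measurable_prod _ fun i _ => hL.comp (measurable_pi_apply i)
    have hh := ENNReal.lintegral_mul_le_Lp_mul_Lq (Measure.pi fun _ : Fin n => P)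
      (p := 2) (q := 2) Real.HolderConjugate.two_two
      (f := S.indicator 1) (g := fun z => ∏ i, L (z i))
      (measurable_one.indicator hS).aemeasurable hprod.aemeasurable
    have e1 : (S.indicator 1 * fun z : Fin n → E => ∏ i, L (z i))
        = S.indicator fun z => ∏ i, L (z i) := by
      ext z
      by_cases hz : z ∈ S <;> simp [hz]
    have e2 : ∫⁻ z, (S.indicator (1 : (Fin n → E) → ENNReal) z) ^ (2 : ℝ)
        ∂(Measure.pi fun _ : Fin n => P) = Measure.pi (fun _ : Fin n => P) S := by
      rw [← lintegral_indicator_one hS]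
      refine lintegral_congr fun z => ?_
      by_cases hz : z ∈ S <;> simp [hz]
    have e3 : ∫⁻ z, (∏ i, L (z i)) ^ (2 : ℝ) ∂(Measure.pi fun _ : Fin n => P)
        = (∫⁻ x, L x ^ 2 ∂P) ^ n := by
      rw [← lintegral_pi_prod_eq_pow P (hL.pow_const 2)]
      refine lintegral_congr fun z => ?_
      rw [ENNReal.rpow_two, Finset.prod_pow]
    rw [e1, e2, e3] at hh
    exact hh

/-- The second moment of the truncated likelihood ratio is bounded by the Hellinger distance. -/
theorem lintegral_truncated_ratio_sq_le {E : Type*} [MeasurableSpace E] {ν : Measure E}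
    {f f' : E → ℝ} (hf : Measurable f) (hf' : Measurable f')
    (hf0 : ∀ x, 0 ≤ f x) (hf0' : ∀ x, 0 ≤ f' x)
    (hP : ∫⁻ x, ENNReal.ofReal (f x) ∂ν = 1) (hQ : ∫⁻ x, ENNReal.ofReal (f' x) ∂ν = 1) :
    ∫⁻ x, ({x | f' x ≤ 4 * f x}.indicator (fun x => ENNReal.ofReal (f' x / f x)) x) ^ 2
        ∂(ν.withDensity fun x => ENNReal.ofReal (f x))
      ≤ 1 + 9 * ∫⁻ x, ENNReal.ofReal ((Real.sqrt (f' x) - Real.sqrt (f x)) ^ 2) ∂ν := by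
  have hA : MeasurableSet {x | f' x ≤ 4 * f x} := measurableSet_le hf' (hf.const_mul 4)
  have hL : Measurable ({x | f' x ≤ 4 * f x}.indicator fun x => ENNReal.ofReal (f' x / f x)) :=
    (hf'.div hf).ennreal_ofReal.indicator hA
  have hΔ : Measurable fun x => ENNReal.ofReal ((Real.sqrt (f' x) - Real.sqrt (f x)) ^ 2) :=
    ((hf'.sqrt.sub hf.sqrt).pow_const 2).ennreal_ofReal
  rw [lintegral_withDensity_eq_lintegral_mul _ hf.ennreal_ofReal (hL.pow_const 2)]
  -- With `a = √f`, `b = √f'`, on the truncation set `f L² - 2 f' + f = (b - a)² (a + b)² / a² ≤ 9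
  -- (b - a)²`, because `b ≤ 2a`. Off the set `f ≤ f'/4`. Terms are moved across to avoid
  -- subtraction in `ENNReal`.
  have key : ∀ x, ((fun x => ENNReal.ofReal (f x)) * fun x =>
        ({x | f' x ≤ 4 * f x}.indicator (fun x => ENNReal.ofReal (f' x / f x)) x) ^ 2) x
        + ENNReal.ofReal (f x)
      ≤ 9 * ENNReal.ofReal ((Real.sqrt (f' x) - Real.sqrt (f x)) ^ 2)
        + 2 * ENNReal.ofReal (f' x) := by
    intro x
    have ha := Real.sqrt_nonneg (f x)
    have hb := Real.sqrt_nonneg (f' x)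
    have hsa := Real.sq_sqrt (hf0 x)
    have hsb := Real.sq_sqrt (hf0' x)
    rw [show (9 : ENNReal) = ENNReal.ofReal 9 by simp, show (2 : ENNReal) = ENNReal.ofReal 2 by simp,
      ← ENNReal.ofReal_mul (by norm_num), ← ENNReal.ofReal_mul (by norm_num),
      ← ENNReal.ofReal_add (by positivity) (by have := hf0' x; positivity)]
    by_cases hx : f' x ≤ 4 * f x
    · have hx' : x ∈ {x | f' x ≤ 4 * f x} := hx
      simp only [Pi.mul_apply, Set.indicator_of_mem hx']
      rw [← ENNReal.ofReal_pow (div_nonneg (hf0' x) (hf0 x)), ← ENNReal.ofReal_mul (hf0 x),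
        ← ENNReal.ofReal_add (mul_nonneg (hf0 x) (sq_nonneg _)) (hf0 x)]
      refine ENNReal.ofReal_le_ofReal ?_
      rcases (hf0 x).eq_or_lt with h0 | h0
      · rw [← h0]
        have := hf0' x
        simp only [zero_mul, zero_add]
        positivity
      · set a := Real.sqrt (f x)
        set b := Real.sqrt (f' x)
        rw [← hsa, ← hsb]
        have hapos : 0 < a := Real.sqrt_pos.2 h0
        have hba : b ≤ 2 * a := by
          have : b ^ 2 ≤ (2 * a) ^ 2 := by rw [hsb, mul_pow, hsa]; linarith
          exact (sq_le_sq₀ hb (by positivity)).1 this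
        have e : a ^ 2 * (b ^ 2 / a ^ 2) ^ 2 = b ^ 4 / a ^ 2 := by field_simp
        rw [e, ← sub_nonneg]
        have e2 : 9 * (b - a) ^ 2 + 2 * b ^ 2 - (b ^ 4 / a ^ 2 + a ^ 2)
            = (b - a) ^ 2 * (9 * a ^ 2 - (a + b) ^ 2) / a ^ 2 := by
          field_simp
          ring
        rw [e2]
        have : 0 ≤ 9 * a ^ 2 - (a + b) ^ 2 := by nlinarith
        positivity
    · have hx' : x ∉ {x | f' x ≤ 4 * f x} := hx
      simp only [Pi.mul_apply, Set.indicator_of_notMem hx']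
      rw [zero_pow two_ne_zero, mul_zero, zero_add]
      refine ENNReal.ofReal_le_ofReal ?_
      have := hf0 x
      nlinarith [sq_nonneg (Real.sqrt (f' x) - Real.sqrt (f x))]
  have h1 := lintegral_mono key (μ := ν)
  rw [lintegral_add_right _ hf.ennreal_ofReal, lintegral_add_right _ (hf'.ennreal_ofReal.const_mul 2),
    lintegral_const_mul _ hΔ, lintegral_const_mul _ hf'.ennreal_ofReal, hP, hQ, mul_one,
    show (2 : ENNReal) = 1 + 1 by norm_num, ← add_assoc] at h1
  rw [add_comm 1]
  exact (ENNReal.add_le_add_iff_right ENNReal.one_ne_top).1 h1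

/-- Differentiability in quadratic mean implies contiguity of the product measures. -/
theorem tendsto_pi_of_quadratic_mean {E : Type*} [MeasurableSpace E] {ν : Measure E}
    {f h : E → ℝ} {fn : ℕ → E → ℝ} (hf : Measurable f) (hfn : ∀ n, Measurable (fn n))
    (hh : Measurable h) (hf0 : ∀ x, 0 ≤ f x) (hfn0 : ∀ n x, 0 ≤ fn n x)
    {P : Measure E} {Q : ℕ → Measure E} [IsProbabilityMeasure P] [∀ n, IsProbabilityMeasure (Q n)]
    (hP : P = ν.withDensity fun x => ENNReal.ofReal (f x))
    (hQ : ∀ n, Q n = ν.withDensity fun x => ENNReal.ofReal (fn n x))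
    (hhint : ∫⁻ x, ENNReal.ofReal (h x ^ 2) ∂ν ≠ ⊤) (hzero : ∀ᵐ x ∂ν, f x = 0 → h x = 0)
    (hD : Tendsto (fun n : ℕ => ∫⁻ x, ENNReal.ofReal
      ((Real.sqrt n * (Real.sqrt (fn n x) - Real.sqrt (f x)) - h x) ^ 2) ∂ν) atTop (𝓝 0))
    {S : (n : ℕ) → Set (Fin n → E)}
    (hS : Tendsto (fun n => Measure.pi (fun _ : Fin n => P) (S n)) atTop (𝓝 0)) :
    Tendsto (fun n => Measure.pi (fun _ : Fin n => Q n) (S n)) atTop (𝓝 0) := by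
  set H := ∫⁻ x, ENNReal.ofReal (h x ^ 2) ∂ν
  set δ : ℕ → ENNReal := fun n => ∫⁻ x, ENNReal.ofReal
      ((Real.sqrt n * (Real.sqrt (fn n x) - Real.sqrt (f x)) - h x) ^ 2) ∂ν
  set A : ℕ → Set E := fun n => {x | fn n x ≤ 4 * f x}
  -- `T n` is where `√n √f < 2 |h|`. It shrinks to a set on which `f = 0` and `h ≠ 0`, null by
  -- `hzero`.
  set T : ℕ → Set E := fun n => {x | n * f x < 4 * h x ^ 2}
  have hA : ∀ n, MeasurableSet (A n) := fun n => measurableSet_le (hfn n) (hf.const_mul 4)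
  have hT : ∀ n, MeasurableSet (T n) := fun n =>
    measurableSet_lt (hf.const_mul _) ((hh.pow_const 2).const_mul 4)
  have hPone : ∫⁻ x, ENNReal.ofReal (f x) ∂ν = 1 := by
    have := measure_univ (μ := P)
    rwa [hP, withDensity_apply _ MeasurableSet.univ, setLIntegral_univ] at this
  have hQone : ∀ n, ∫⁻ x, ENNReal.ofReal (fn n x) ∂ν = 1 := fun n => by
    have := measure_univ (μ := Q n)
    rwa [hQ, withDensity_apply _ MeasurableSet.univ, setLIntegral_univ] at this
  have hmD : ∀ n : ℕ, Measurable fun x =>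
      Real.sqrt n * (Real.sqrt (fn n x) - Real.sqrt (f x)) - h x := fun n =>
    (((hfn n).sqrt.sub hf.sqrt).const_mul _).sub hh
  have hmδ : ∀ n : ℕ, Measurable fun x => ENNReal.ofReal
      ((Real.sqrt n * (Real.sqrt (fn n x) - Real.sqrt (f x)) - h x) ^ 2) := fun n =>
    ((hmD n).pow_const 2).ennreal_ofReal
  have hmh : Measurable fun x => ENNReal.ofReal (h x ^ 2) := (hh.pow_const 2).ennreal_ofReal
  -- the exceptional sets
  have htail : Tendsto (fun n => ∫⁻ x, (T n).indicator (fun x => ENNReal.ofReal (h x ^ 2)) x ∂ν)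
      atTop (𝓝 0) := by
    have := tendsto_lintegral_of_dominated_convergence (μ := ν)
      (F := fun n x => (T n).indicator (fun x => ENNReal.ofReal (h x ^ 2)) x) (f := fun _ => 0)
      (fun x => ENNReal.ofReal (h x ^ 2)) (fun n => hmh.indicator (hT n))
      (fun n => Eventually.of_forall fun x => Set.indicator_le_self _ _ _) hhint ?_
    · simpa using this
    · filter_upwards [hzero] with x hx
      refine tendsto_const_nhds.congr' ?_
      rcases (hf0 x).eq_or_lt with h0 | h0
      · filter_upwards with n
        by_cases hxT : x ∈ T n <;> simp [hxT, hx h0.symm]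
      · have : ∀ᶠ n : ℕ in atTop, 4 * h x ^ 2 / f x ≤ n :=
          tendsto_natCast_atTop_atTop.eventually_ge_atTop _
        filter_upwards [this] with n hn
        rw [div_le_iff₀ h0] at hn
        exact (Set.indicator_of_notMem (fun hxT : x ∈ T n => absurd hxT (not_lt.2 hn)) _).symm
  -- Off `A n` one has `b ≥ 2a`, so `n fₙ ≤ 4 (√n (b - a))² = 4 (D + h)²` with `D` the
  -- quadratic-mean error. On `T n` this is at most `8 D² + 8 h²`. Off `T n`, `2 |h| ≤ √n (b - a)`
  -- forces `√n (b - a) ≤ 2 D`, giving `16 D²`.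
  have hbad : ∀ n : ℕ, n * Q n (A n)ᶜ
      ≤ 16 * δ n + 8 * ∫⁻ x, (T n).indicator (fun x => ENNReal.ofReal (h x ^ 2)) x ∂ν := by
    intro n
    rw [hQ, withDensity_apply _ (hA n).compl, ← lintegral_indicator (hA n).compl,
      ← lintegral_const_mul _ ((hfn n).ennreal_ofReal.indicator (hA n).compl),
      ← lintegral_const_mul _ (hmδ n), ← lintegral_const_mul _ (hmh.indicator (hT n)),
      ← lintegral_add_left ((hmδ n).const_mul _)]
    refine lintegral_mono fun x => ?_
    by_cases hx : x ∈ A n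
    · rw [Set.indicator_of_notMem (by simpa using hx)]
      simp
    · have hx' : x ∈ (A n)ᶜ := hx
      rw [Set.indicator_of_mem hx']
      have hlt : 4 * f x < fn n x := not_le.1 hx
      have ha := Real.sqrt_nonneg (f x)
      have hb := Real.sqrt_nonneg (fn n x)
      have hsa := Real.sq_sqrt (hf0 x)
      have hsb := Real.sq_sqrt (hfn0 n x)
      have hsn := Real.sq_sqrt (Nat.cast_nonneg (α := ℝ) n)
      have hsn0 := Real.sqrt_nonneg (n : ℝ)
      set a := Real.sqrt (f x)
      set b := Real.sqrt (fn n x)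
      set r := Real.sqrt (n : ℝ)
      have hab : 2 * a ≤ b := by
        have : (2 * a) ^ 2 ≤ b ^ 2 := by rw [hsb, mul_pow, hsa]; linarith
        exact (sq_le_sq₀ (by positivity) hb).1 this
      have hDn : (n : ℝ) * fn n x ≤ 4 * (r * (b - a)) ^ 2 := by
        rw [← hsn, ← hsb, mul_pow]
        have : b ^ 2 ≤ 4 * (b - a) ^ 2 := by nlinarith
        nlinarith [mul_le_mul_of_nonneg_left this (sq_nonneg r)]
      have e1 : (n : ENNReal) * ENNReal.ofReal (fn n x) = ENNReal.ofReal (n * fn n x) := by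
        rw [ENNReal.ofReal_mul (Nat.cast_nonneg n), ENNReal.ofReal_natCast]
      have e2 : ∀ y : ℝ, (16 : ENNReal) * ENNReal.ofReal y = ENNReal.ofReal (16 * y) := fun y => by
        rw [ENNReal.ofReal_mul (by norm_num)]
        simp
      have e3 : ∀ y : ℝ, (8 : ENNReal) * ENNReal.ofReal y = ENNReal.ofReal (8 * y) := fun y => by
        rw [ENNReal.ofReal_mul (by norm_num)]
        simp
      rw [e1, e2]
      by_cases hxT : x ∈ T n
      · rw [Set.indicator_of_mem hxT, e3, ← ENNReal.ofReal_add (by positivity) (by positivity)]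
        refine ENNReal.ofReal_le_ofReal (hDn.trans ?_)
        nlinarith [sq_nonneg (r * (b - a) - 2 * h x), sq_nonneg (r * (b - a) - h x)]
      · rw [Set.indicator_of_notMem hxT, mul_zero, add_zero]
        refine ENNReal.ofReal_le_ofReal (hDn.trans ?_)
        have hge : (2 * |h x|) ^ 2 ≤ (r * a) ^ 2 := by
          rw [mul_pow, mul_pow, sq_abs, hsn, hsa]
          have : 4 * h x ^ 2 ≤ n * f x := not_lt.1 hxT
          linarith
        have h1 : 2 * |h x| ≤ r * a := (sq_le_sq₀ (by positivity) (by positivity)).1 hge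
        have h2 : r * a ≤ r * (b - a) := mul_le_mul_of_nonneg_left (by linarith) hsn0
        have h3 := le_abs_self (h x)
        have h4 : r * (b - a) ≤ 2 * (r * (b - a) - h x) := by linarith
        have h5 : 0 ≤ r * (b - a) := mul_nonneg hsn0 (by linarith)
        have := pow_le_pow_left₀ h5 h4 2
        nlinarith
  have hbad0 : Tendsto (fun n : ℕ => n * Q n (A n)ᶜ) atTop (𝓝 0) := by
    have := (ENNReal.Tendsto.const_mul hD (Or.inr (by norm_num : (16 : ENNReal) ≠ ⊤))).add
      (ENNReal.Tendsto.const_mul htail (Or.inr (by norm_num : (8 : ENNReal) ≠ ⊤)))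
    rw [mul_zero, mul_zero, add_zero] at this
    exact tendsto_of_tendsto_of_tendsto_of_le_of_le tendsto_const_nhds this
      (fun _ => zero_le) hbad
  -- the Hellinger distances
  set I : ℕ → ENNReal := fun n =>
    ∫⁻ x, ENNReal.ofReal ((Real.sqrt (fn n x) - Real.sqrt (f x)) ^ 2) ∂ν
  have hI : ∀ n : ℕ, n * I n ≤ 2 * δ n + 2 * H := by
    intro n
    have hmI : Measurable fun x =>
        ENNReal.ofReal ((Real.sqrt (fn n x) - Real.sqrt (f x)) ^ 2) :=
      (((hfn n).sqrt.sub hf.sqrt).pow_const 2).ennreal_ofReal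
    rw [← lintegral_const_mul _ hmI,
      ← lintegral_const_mul _ (hmδ n), ← lintegral_const_mul _ hmh,
      ← lintegral_add_left ((hmδ n).const_mul _)]
    refine lintegral_mono fun x => ?_
    have hsn := Real.sq_sqrt (Nat.cast_nonneg (α := ℝ) n)
    have e2 : ∀ y : ℝ, (2 : ENNReal) * ENNReal.ofReal y = ENNReal.ofReal (2 * y) := fun y => by
      rw [ENNReal.ofReal_mul (by norm_num)]
      simp
    rw [e2, e2, ← ENNReal.ofReal_natCast, ← ENNReal.ofReal_mul (Nat.cast_nonneg n),
      ← ENNReal.ofReal_add (by positivity) (by positivity)]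
    refine ENNReal.ofReal_le_ofReal ?_
    have e4 : (n : ℝ) * (Real.sqrt (fn n x) - Real.sqrt (f x)) ^ 2
        = (Real.sqrt n * (Real.sqrt (fn n x) - Real.sqrt (f x))) ^ 2 := by rw [mul_pow, hsn]
    rw [e4]
    nlinarith [sq_nonneg (Real.sqrt n * (Real.sqrt (fn n x) - Real.sqrt (f x)) - 2 * h x)]
  -- `K` bounds `n I n` once `δ n ≤ 1`, so the `n`-fold second moment is at most `(1 + 9 K / n)ⁿ ≤
  -- exp (9 K)`.
  set K : ℝ := 2 + 2 * H.toReal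
  have hK0 : 0 ≤ K := by positivity
  have hpow : ∀ᶠ n : ℕ in atTop, (1 + 9 * I n) ^ n ≤ ENNReal.ofReal (Real.exp (9 * K)) := by
    filter_upwards [hD.eventually (ge_mem_nhds one_pos), eventually_gt_atTop 0] with n hn hn0
    have hn0' : (0 : ℝ) < n := Nat.cast_pos.2 hn0
    have h1 : n * I n ≤ ENNReal.ofReal K := by
      refine (hI n).trans ?_
      rw [ENNReal.ofReal_add (by norm_num) (by positivity), ENNReal.ofReal_mul (by norm_num),
        ENNReal.ofReal_toReal hhint]
      simp only [ENNReal.ofReal_ofNat]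
      gcongr
      exact (mul_le_mul_right hn 2).trans (by simp)
    have h2 : I n ≤ ENNReal.ofReal (K / n) := by
      rw [ENNReal.ofReal_div_of_pos hn0', ENNReal.le_div_iff_mul_le
        (Or.inl (by simpa using hn0.ne')) (Or.inl ENNReal.ofReal_ne_top), mul_comm,
        ENNReal.ofReal_natCast]
      exact h1
    calc (1 + 9 * I n) ^ n ≤ (1 + 9 * ENNReal.ofReal (K / n)) ^ n := by gcongr
      _ = ENNReal.ofReal ((1 + 9 * (K / n)) ^ n) := by
        rw [ENNReal.ofReal_pow (by positivity), ENNReal.ofReal_add (by norm_num) (by positivity),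
          ENNReal.ofReal_mul (by norm_num)]
        simp
      _ ≤ ENNReal.ofReal (Real.exp (9 * K)) := by
        refine ENNReal.ofReal_le_ofReal ?_
        calc (1 + 9 * (K / n)) ^ n ≤ (Real.exp (9 * (K / n))) ^ n := by
              gcongr
              linarith [Real.add_one_le_exp (9 * (K / n))]
          _ = Real.exp (9 * K) := by
              rw [← Real.exp_nat_mul]
              congr 1
              field_simp
  set S' : (n : ℕ) → Set (Fin n → E) := fun n =>
    toMeasurable (Measure.pi fun _ : Fin n => P) (S n)
  have hbound : ∀ᶠ n : ℕ in atTop, Measure.pi (fun _ : Fin n => Q n) (S n)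
      ≤ n * Q n (A n)ᶜ + (Measure.pi (fun _ : Fin n => P) (S n)) ^ (1 / 2 : ℝ)
        * (ENNReal.ofReal (Real.exp (9 * K))) ^ (1 / 2 : ℝ) := by
    filter_upwards [hpow] with n hn
    have hL : Measurable ((A n).indicator fun x => ENNReal.ofReal (fn n x / f x)) :=
      ((hfn n).div hf).ennreal_ofReal.indicator (hA n)
    have hres : (Q n).restrict (A n)
        = P.withDensity ((A n).indicator fun x => ENNReal.ofReal (fn n x / f x)) := by
      rw [hQ, hP, restrict_withDensity (hA n), ← withDensity_indicator (hA n),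
        ← withDensity_mul _ hf.ennreal_ofReal hL]
      congr 1
      ext x
      by_cases hx : x ∈ A n
      · simp only [Pi.mul_apply, Set.indicator_of_mem hx]
        rw [← ENNReal.ofReal_mul (hf0 x)]
        congr 1
        rcases (hf0 x).eq_or_lt with h0 | h0
        · have : fn n x ≤ 4 * f x := hx
          have := hfn0 n x
          rw [← h0]
          linarith
        · field_simp
      · simp [Set.indicator_of_notMem hx]
    -- `S n` need not be measurable; its hull has the same null probability.
    refine (measure_mono (subset_toMeasurable (Measure.pi fun _ : Fin n => P) (S n))).trans ?_
    refine (measure_pi_le_of_restrict_eq_withDensity P (Q n) hL (hA n) hres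
      (measurableSet_toMeasurable _ _)).trans ?_
    rw [measure_toMeasurable]
    gcongr
    refine le_trans ?_ hn
    gcongr
    have := lintegral_truncated_ratio_sq_le hf (hfn n) hf0 (hfn0 n) hPone (hQone n)
    rwa [← hP] at this
  have hlim : Tendsto (fun n : ℕ => n * Q n (A n)ᶜ
      + (Measure.pi (fun _ : Fin n => P) (S n)) ^ (1 / 2 : ℝ)
        * (ENNReal.ofReal (Real.exp (9 * K))) ^ (1 / 2 : ℝ)) atTop (𝓝 0) := by
    have h1 := (ENNReal.continuous_rpow_const (y := (1 / 2 : ℝ))).tendsto 0 |>.comp hS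
    rw [ENNReal.zero_rpow_of_pos (by norm_num)] at h1
    have h2 := hbad0.add (ENNReal.Tendsto.mul_const h1
      (b := (ENNReal.ofReal (Real.exp (9 * K))) ^ (1 / 2 : ℝ))
      (Or.inr (ENNReal.rpow_ne_top_of_nonneg (by norm_num) ENNReal.ofReal_ne_top)))
    simpa using h2
  exact tendsto_of_tendsto_of_tendsto_of_le_of_le' tendsto_const_nhds hlim
    (Eventually.of_forall fun _ => zero_le) hbound

/-! ### Quadratic-mean differentiability of location shifts -/

theorem enorm_sq_eq_ofReal_sq (x : ℝ) : ‖x‖ₑ ^ 2 = ENNReal.ofReal (x ^ 2) := by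
  rw [← ofReal_norm, ← ENNReal.ofReal_pow (norm_nonneg _), Real.norm_eq_abs, sq_abs]

theorem sq_lintegral_le_lintegral_sq {α : Type*} [MeasurableSpace α] (μ : Measure α)
    [IsProbabilityMeasure μ] {F : α → ENNReal} (hF : AEMeasurable F μ) :
    (∫⁻ x, F x ∂μ) ^ 2 ≤ ∫⁻ x, F x ^ 2 ∂μ := by
  have h := ENNReal.lintegral_mul_le_Lp_mul_Lq μ Real.HolderConjugate.two_two hF
    (aemeasurable_const (b := (1 : ENNReal)))
  simp only [Pi.mul_apply, mul_one, lintegral_const, measure_univ, ENNReal.rpow_two, one_pow,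
    ENNReal.one_rpow] at h
  calc (∫⁻ x, F x ∂μ) ^ 2 ≤ ((∫⁻ x, F x ^ 2 ∂μ) ^ (1 / 2 : ℝ)) ^ 2 := by gcongr
    _ = ∫⁻ x, F x ^ 2 ∂μ := by
      rw [← ENNReal.rpow_two, ← ENNReal.rpow_mul]
      norm_num

theorem ofReal_sq_integral_le {α : Type*} [MeasurableSpace α] (μ : Measure α)
    [IsProbabilityMeasure μ] {F : α → ℝ} (hF : AEMeasurable F μ) :
    ENNReal.ofReal ((∫ x, F x ∂μ) ^ 2) ≤ ∫⁻ x, ENNReal.ofReal (F x ^ 2) ∂μ := by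
  rw [← enorm_sq_eq_ofReal_sq]
  simp_rw [← enorm_sq_eq_ofReal_sq]
  calc ‖∫ x, F x ∂μ‖ₑ ^ 2 ≤ (∫⁻ x, ‖F x‖ₑ ∂μ) ^ 2 := by
        gcongr
        exact enorm_integral_le_lintegral_enorm _
    _ ≤ _ := sq_lintegral_le_lintegral_sq μ hF.enorm

/-- Translations are continuous in quadratic mean. -/
theorem tendsto_lintegral_sq_translate_sub {r : ℝ → ℝ} (hr : Measurable r)
    (hr2 : ∫⁻ y, ENNReal.ofReal (r y ^ 2) ≠ ⊤) :
    Tendsto (fun a : ℝ => ∫⁻ y, ENNReal.ofReal ((r (a + y) - r y) ^ 2)) (𝓝 0) (𝓝 0) := by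
  have hsq : ∀ g : ℝ → ℝ, eLpNorm g 2 volume ^ 2 = ∫⁻ y, ENNReal.ofReal (g y ^ 2) := by
    intro g
    have := eLpNorm_nnreal_pow_eq_lintegral (f := g) (μ := volume) (p := 2) two_ne_zero
    simp only [NNReal.coe_ofNat, ENNReal.coe_ofNat, ENNReal.rpow_two] at this
    rw [this]
    exact lintegral_congr fun y => enorm_sq_eq_ofReal_sq _
  have hmem : MemLp r 2 volume := by
    refine ⟨hr.aestronglyMeasurable, lt_top_iff_ne_top.2 fun h => hr2 ?_⟩
    rw [← hsq, h]
    rfl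
  have : Fact ((2 : ENNReal) ≠ ⊤) := ⟨by norm_num⟩
  -- This is the strong continuity of the translation action on `L²`.
  have hc : Continuous fun a : ℝ => DomAddAct.mk a +ᵥ hmem.toLp r :=
    (continuous_vadd (M := ℝᵈᵃᵃ) (X := Lp ℝ 2 (volume : Measure ℝ))).comp
      (DomAddAct.continuous_mk.prodMk continuous_const)
  have ht := (hc.tendsto 0).edist (tendsto_const_nhds (x := hmem.toLp r))
  have e : ∀ a : ℝ, edist (DomAddAct.mk a +ᵥ hmem.toLp r) (hmem.toLp r) ^ 2
      = ∫⁻ y, ENNReal.ofReal ((r (a + y) - r y) ^ 2) := by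
    intro a
    rw [DomAddAct.mk_vadd_toLp, Lp.edist_toLp_toLp, hsq]
    rfl
  have h0 : edist (DomAddAct.mk (0 : ℝ) +ᵥ hmem.toLp r) (hmem.toLp r) = 0 := by
    simp
  rw [h0] at ht
  have := (ENNReal.continuous_pow 2).tendsto 0 |>.comp ht
  simpa [Function.comp_def, e] using this

/-- Provides the majorant for dominated convergence over the covariate. -/
theorem lintegral_sq_translate_sub_le {r : ℝ → ℝ} (hr : Measurable r) (a : ℝ) :
    ∫⁻ y, ENNReal.ofReal ((r (a + y) - r y) ^ 2) ≤ 4 * ∫⁻ y, ENNReal.ofReal (r y ^ 2) := by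
  have hm : Measurable fun y => ENNReal.ofReal (r y ^ 2) := (hr.pow_const 2).ennreal_ofReal
  have hm' : Measurable fun y => ENNReal.ofReal (r (a + y) ^ 2) :=
    hm.comp (measurable_const_add a)
  have e := lintegral_add_left_eq_self (μ := volume) (fun y => ENNReal.ofReal (r y ^ 2)) a
  calc ∫⁻ y, ENNReal.ofReal ((r (a + y) - r y) ^ 2)
      ≤ ∫⁻ y, (2 * ENNReal.ofReal (r (a + y) ^ 2) + 2 * ENNReal.ofReal (r y ^ 2)) := by
        refine lintegral_mono fun y => ?_
        have e2 : ∀ z : ℝ, (2 : ENNReal) * ENNReal.ofReal z = ENNReal.ofReal (2 * z) := fun z => by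
          rw [ENNReal.ofReal_mul (by norm_num)]
          simp
        rw [e2, e2, ← ENNReal.ofReal_add (by positivity) (by positivity)]
        refine ENNReal.ofReal_le_ofReal ?_
        nlinarith [sq_nonneg (r (a + y) + r y)]
    _ = 4 * ∫⁻ y, ENNReal.ofReal (r y ^ 2) := by
        rw [lintegral_add_right _ (hm.const_mul 2), lintegral_const_mul _ hm,
          lintegral_const_mul _ hm', e, ← add_mul]
        norm_num

/-- Taylor remainder of an absolutely continuous function in quadratic mean. -/
theorem lintegral_sq_increment_sub_le {s r : ℝ → ℝ} (hr : Measurable r)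
    (h : ∀ a b : ℝ, IntervalIntegrable r volume a b ∧ s b - s a = ∫ y in a..b, r y) (c : ℝ) :
    ∫⁻ y, ENNReal.ofReal ((s (y + c) - s y - c * r y) ^ 2)
      ≤ ENNReal.ofReal (c ^ 2) * ∫⁻ u in Set.Ioc (0 : ℝ) 1,
        ∫⁻ y, ENNReal.ofReal ((r (c * u + y) - r y) ^ 2) := by
  rcases eq_or_ne c 0 with rfl | hc
  · simp
  have : IsProbabilityMeasure (volume.restrict (Set.Ioc (0 : ℝ) 1)) := ⟨by simp⟩
  -- The increment is `c` times the average of `r` over the segment; Jensen in `u` and Tonelli then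
  -- give the bound.
  have hrep : ∀ y, s (y + c) - s y - c * r y
      = c * ∫ u in Set.Ioc (0 : ℝ) 1, (r (c * u + y) - r y) := by
    intro y
    have h1 : IntervalIntegrable (fun u => r (c * u + y)) volume 0 1 := by
      have := ((h (0 + y) (c + y)).1.comp_add_right y).comp_mul_left (c := c)
      simpa [hc] using this
    rw [← intervalIntegral.integral_of_le zero_le_one,
      intervalIntegral.integral_sub h1 intervalIntegrable_const, mul_sub]
    have h2 := intervalIntegral.smul_integral_comp_mul_add (a := 0) (b := 1) r c y
    simp only [smul_eq_mul, mul_zero, mul_one, zero_add] at h2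
    rw [h2, (h y (y + c)).2, add_comm y c]
    simp
  have hm : Measurable fun z : ℝ × ℝ => ENNReal.ofReal ((r (c * z.2 + z.1) - r z.1) ^ 2) := by
    fun_prop
  calc ∫⁻ y, ENNReal.ofReal ((s (y + c) - s y - c * r y) ^ 2)
      ≤ ∫⁻ y, ENNReal.ofReal (c ^ 2) * ∫⁻ u in Set.Ioc (0 : ℝ) 1,
          ENNReal.ofReal ((r (c * u + y) - r y) ^ 2) := by
        refine lintegral_mono fun y => ?_
        rw [hrep, mul_pow, ENNReal.ofReal_mul (sq_nonneg c)]
        gcongr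
        exact ofReal_sq_integral_le _ (by fun_prop)
    _ = _ := by
        rw [lintegral_const_mul _ hm.lintegral_prod_right',
          lintegral_lintegral_swap hm.aemeasurable]

/-- The derivative of a nonnegative absolutely continuous function vanishes almost everywhere on
its zero set. -/
theorem ae_derivative_eq_zero_of_nonneg {s r : ℝ → ℝ} (hs0 : ∀ y, 0 ≤ s y)
    (h : ∀ a b : ℝ, IntervalIntegrable r volume a b ∧ s b - s a = ∫ y in a..b, r y) :
    ∀ᵐ y, s y = 0 → r y = 0 := by
  have hloc : LocallyIntegrable r volume := by
    rw [locallyIntegrable_iff]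
    intro K hK
    have hab := (IsCompact.isBounded hK : Bornology.IsBounded K).subset_Icc_sInf_sSup
    set a := sInf K
    set b := sSup K
    refine IntegrableOn.mono_set ?_ hab
    rcases le_total a b with h' | h'
    · exact (intervalIntegrable_iff_integrableOn_Icc_of_le h').1 (h a b).1
    · rcases h'.eq_or_lt with h' | h'
      · simp [h']
      · simp [Set.Icc_eq_empty (not_le.2 h')]
  filter_upwards [LocallyIntegrable.ae_hasDerivAt_integral hloc] with y hy hsy
  -- By Lebesgue differentiation `s' = r` at almost every point, and a zero of a nonnegative
  -- function is a minimum.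
  have hd : HasDerivAt s (r y) y := by
    have := (hy 0).const_add (s 0)
    refine this.congr_of_eventuallyEq (Eventually.of_forall fun z => ?_)
    have := (h 0 z).2
    simp only [← this]
    ring
  exact IsLocalMin.hasDerivAt_eq_zero (Eventually.of_forall fun z => hsy ▸ hs0 z) hd

theorem map_withDensity_eq_of_measurePreserving {E : Type*} [MeasurableSpace E] {ν : Measure E}
    {T : E → E} (hT : MeasurePreserving T ν ν) {k : E → ENNReal} (hk : Measurable k) :
    (ν.withDensity fun z => k (T z)).map T = ν.withDensity k := by
  ext B hB
  rw [Measure.map_apply hT.measurable hB, withDensity_apply _ (hT.measurable hB),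
    withDensity_apply _ hB, ← hT.setLIntegral_comp_preimage hB hk]

/-- `P` is absolutely continuous with respect to a product with Lebesgue measure, for which
horizontal slices are null. -/
theorem FiniteLocationInformation.nullSingletonClass {p : ℕ} {P : Measure (Cov p × ℝ)}
    {γ : Cov p → ℝ} (h : FiniteLocationInformation P γ) :
    NullSingletonClass (P.map Prod.snd) := by
  obtain ⟨f, r, -, -, -, hP, -⟩ := h
  refine ⟨fun t => ?_⟩
  rw [Measure.map_apply measurable_snd (measurableSet_singleton t)]
  have hac : P ≪ (P.map Prod.fst).prod volume := by
    conv_lhs => rw [hP]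
    exact withDensity_absolutelyContinuous _ _
  refine hac ?_
  rw [← Set.univ_prod, Measure.prod_prod]
  simp

/-- Contiguity of the local shifts of the response under finite location information. -/
theorem FiniteLocationInformation.tendsto_pi_map_shift {p : ℕ} {P : Measure (Cov p × ℝ)}
    [IsProbabilityMeasure P] {γ : Cov p → ℝ} (hγ : Measurable γ)
    (hinfo : FiniteLocationInformation P γ) {S : (n : ℕ) → Set (Fin n → Cov p × ℝ)}
    (hS : Tendsto (fun n => Measure.pi (fun _ : Fin n => P) (S n)) atTop (𝓝 0)) :
    Tendsto (fun n : ℕ => Measure.pi (fun _ : Fin n =>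
      P.map fun z => (z.1, z.2 + 1 / Real.sqrt n * γ z.1)) (S n)) atTop (𝓝 0) := by
  obtain ⟨f, r, hf, hr, hf0, hP, hac, hfin⟩ := hinfo
  set κ := P.map Prod.fst
  have : IsProbabilityMeasure κ := Measure.isProbabilityMeasure_map measurable_fst.aemeasurable
  set ν := κ.prod (volume : Measure ℝ)
  -- Moving the response up by `γ/√n` evaluates the density at `y - γ/√n`, whence the sign; the
  -- derivative of the root density along the shift is `-γ r`.
  set c : ℕ → Cov p → ℝ := fun n x => -(1 / Real.sqrt n * γ x)
  have hc : ∀ n, Measurable (c n) := fun n => (hγ.const_mul _).neg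
  set T : ℕ → Cov p × ℝ → Cov p × ℝ := fun n z => (z.1, z.2 + 1 / Real.sqrt n * γ z.1)
  have hTm : ∀ n, Measurable (T n) := fun n => by fun_prop
  have hT : ∀ n, MeasurePreserving (T n) ν ν := fun n =>
    (MeasurePreserving.id κ).skew_product (g := fun x y => y + 1 / Real.sqrt n * γ x)
      (by fun_prop)
      (Eventually.of_forall fun x => (measurePreserving_add_right volume _).map_eq)
  set fn : ℕ → Cov p × ℝ → ℝ := fun n z => f z.1 (z.2 + c n z.1)
  have hfm : Measurable fun z : Cov p × ℝ => f z.1 z.2 := hf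
  have hrm : Measurable fun z : Cov p × ℝ => r z.1 z.2 := hr
  have hfn : ∀ n, Measurable (fn n) := fun n =>
    hfm.comp (measurable_fst.prodMk (measurable_snd.add ((hc n).comp measurable_fst)))
  have hQ : ∀ n, P.map (T n) = ν.withDensity fun z => ENNReal.ofReal (fn n z) := by
    intro n
    rw [← map_withDensity_eq_of_measurePreserving (hT n) (hfn n).ennreal_ofReal]
    conv_lhs => rw [hP]
    congr 2
    ext z
    simp [fn, T, c]
  have hQp : ∀ n, IsProbabilityMeasure (P.map (T n)) := fun n =>
    Measure.isProbabilityMeasure_map (hTm n).aemeasurable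
  set J : Cov p → ENNReal := fun x => ∫⁻ y, ENNReal.ofReal (r x y ^ 2)
  have hJ : Measurable J := (hrm.pow_const 2).ennreal_ofReal.lintegral_prod_right'
  have hγ2 : Measurable fun x => ENNReal.ofReal (γ x ^ 2) := (hγ.pow_const 2).ennreal_ofReal
  have hh : Measurable fun z : Cov p × ℝ => -(γ z.1 * r z.1 z.2) :=
    ((hγ.comp measurable_fst).mul hrm).neg
  have hrx : ∀ x, Measurable (r x) := fun x => hrm.comp measurable_prodMk_left
  refine tendsto_pi_of_quadratic_mean (ν := ν) (f := fun z => f z.1 z.2)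
    (h := fun z => -(γ z.1 * r z.1 z.2)) (fn := fn) hfm hfn hh (fun z => hf0 _ _)
    (fun n z => hf0 _ _) hP hQ ?_ ?_ ?_ hS
  · rw [lintegral_prod _ (hh.pow_const 2).ennreal_ofReal.aemeasurable]
    refine (lt_of_le_of_lt (lintegral_mono fun x => ?_) hfin).ne
    simp_rw [neg_sq, mul_pow, ENNReal.ofReal_mul (sq_nonneg (γ x))]
    rw [lintegral_const_mul _ ((hrx x).pow_const 2).ennreal_ofReal]
    gcongr
    exact le_mul_of_one_le_left zero_le (by norm_num)
  · have hms : MeasurableSet {z : Cov p × ℝ | f z.1 z.2 = 0 → -(γ z.1 * r z.1 z.2) = 0} := by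
      have : {z : Cov p × ℝ | f z.1 z.2 = 0 → -(γ z.1 * r z.1 z.2) = 0}
          = {z | f z.1 z.2 = 0}ᶜ ∪ {z | -(γ z.1 * r z.1 z.2) = 0} := by
        ext z
        simp [imp_iff_not_or]
      rw [this]
      exact (hfm (measurableSet_singleton 0)).compl.union (hh (measurableSet_singleton 0))
    refine (Measure.ae_prod_iff_ae_ae hms).2 ?_
    filter_upwards [hac] with x hx
    filter_upwards [ae_derivative_eq_zero_of_nonneg (fun y => Real.sqrt_nonneg (f x y)) hx]
      with y hy h0
    rw [hy (by rw [h0, Real.sqrt_zero])]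
    simp
  · have hmD : ∀ n : ℕ, Measurable fun z : Cov p × ℝ => ENNReal.ofReal
        ((Real.sqrt n * (Real.sqrt (fn n z) - Real.sqrt (f z.1 z.2))
          - -(γ z.1 * r z.1 z.2)) ^ 2) := fun n =>
      ((((((hfn n).sqrt).sub hfm.sqrt).const_mul _).sub hh).pow_const 2).ennreal_ofReal
    refine Tendsto.congr (fun n => (lintegral_prod _ (hmD n).aemeasurable).symm) ?_
    -- `ω x` is the squared `L²` modulus of continuity of `r x`. Since `√n c n x = -γ x`, the error
    -- at `x` is at most `γ(x)²` times an average of `ω x` over shifts of size at most `|c n x|`;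
    -- the majorant `4 γ² J` is integrable by the information condition.
    set ω : Cov p → ℝ → ENNReal := fun x a => ∫⁻ y, ENNReal.ofReal ((r x (a + y) - r x y) ^ 2)
    have hle : ∀ᶠ n : ℕ in atTop, ∀ᵐ x ∂κ, ∫⁻ y, ENNReal.ofReal
        ((Real.sqrt n * (Real.sqrt (fn n (x, y)) - Real.sqrt (f x y)) - -(γ x * r x y)) ^ 2)
        ≤ ENNReal.ofReal (γ x ^ 2) * ∫⁻ u in Set.Ioc (0 : ℝ) 1, ω x (c n x * u) := by
      filter_upwards [eventually_gt_atTop 0] with n hn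
      filter_upwards [hac] with x hx
      have hn' : (0 : ℝ) < Real.sqrt n := Real.sqrt_pos.2 (Nat.cast_pos.2 hn)
      have h1 := lintegral_sq_increment_sub_le (hrx x) hx (c n x)
      have e : Real.sqrt n * c n x = -γ x := by
        simp only [c]
        field_simp
      have e2 : ∀ y, ENNReal.ofReal ((Real.sqrt n * (Real.sqrt (fn n (x, y)) - Real.sqrt (f x y))
            - -(γ x * r x y)) ^ 2) = ENNReal.ofReal (Real.sqrt n ^ 2) * ENNReal.ofReal
            ((Real.sqrt (f x (y + c n x)) - Real.sqrt (f x y) - c n x * r x y) ^ 2) := by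
        intro y
        rw [← ENNReal.ofReal_mul (sq_nonneg _), ← mul_pow]
        congr 2
        simp only [fn]
        linear_combination (r x y) * e
      simp_rw [e2]
      rw [lintegral_const_mul' _ _ ENNReal.ofReal_ne_top]
      refine (mul_le_mul_right h1 _).trans_eq ?_
      rw [← mul_assoc, ← ENNReal.ofReal_mul (sq_nonneg _), ← mul_pow, e, neg_sq]
    have hω : ∀ x a, ω x a ≤ 4 * J x := fun x a => lintegral_sq_translate_sub_le (hrx x) a
    have hint : ∀ x, ∀ d : ℝ → ℝ, ∀ ε, (∀ u ∈ Set.Ioc (0 : ℝ) 1, ω x (d u) ≤ ε) →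
        ∫⁻ u in Set.Ioc (0 : ℝ) 1, ω x (d u) ≤ ε := by
      intro x d ε hd
      refine (setLIntegral_mono' measurableSet_Ioc hd).trans ?_
      simp
    have hdct := tendsto_lintegral_filter_of_dominated_convergence (μ := κ) (l := atTop)
      (F := fun (n : ℕ) x => ∫⁻ y, ENNReal.ofReal
        ((Real.sqrt n * (Real.sqrt (fn n (x, y)) - Real.sqrt (f x y)) - -(γ x * r x y)) ^ 2))
      (f := fun _ => 0) (fun x => ENNReal.ofReal (γ x ^ 2) * (4 * J x))
      (Eventually.of_forall fun n => (hmD n).lintegral_prod_right') ?_ hfin.ne ?_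
    · simpa using hdct
    · filter_upwards [hle] with n hn
      filter_upwards [hn] with x hx
      refine hx.trans ?_
      gcongr
      exact hint x _ _ fun u _ => hω x _
    · have hle' : ∀ᵐ x ∂κ, ∀ᶠ n : ℕ in atTop, ∫⁻ y, ENNReal.ofReal
          ((Real.sqrt n * (Real.sqrt (fn n (x, y)) - Real.sqrt (f x y)) - -(γ x * r x y)) ^ 2)
          ≤ ENNReal.ofReal (γ x ^ 2) * ∫⁻ u in Set.Ioc (0 : ℝ) 1, ω x (c n x * u) := by
        obtain ⟨N, hN⟩ := eventually_atTop.1 hle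
        have := ae_all_iff.2 fun n : {n // N ≤ n} => hN n.1 n.2
        filter_upwards [this] with x hx
        filter_upwards [eventually_ge_atTop N] with n hn using hx ⟨n, hn⟩
      have hlt := ae_lt_top (hγ2.mul (hJ.const_mul 4)) hfin.ne
      filter_upwards [hle', hlt] with x hx hxlt
      refine tendsto_of_tendsto_of_tendsto_of_le_of_le' tendsto_const_nhds ?_
        (Eventually.of_forall fun _ => zero_le) hx
      -- Only `γ² J` is integrable: `J x` may be infinite where `γ x = 0`, but there the bound is
      -- already zero.
      rcases eq_or_ne (γ x) 0 with h0 | h0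
      · simp [h0]
      · have hJx : J x ≠ ⊤ := by
          intro hJt
          have : ENNReal.ofReal (γ x ^ 2) ≠ 0 := by
            rw [Ne, ENNReal.ofReal_eq_zero, not_le]
            positivity
          simp [hJt, ENNReal.mul_top this] at hxlt
        have hcont := tendsto_lintegral_sq_translate_sub (hrx x) hJx
        have hc0 : Tendsto (fun n : ℕ => |c n x|) atTop (𝓝 0) := by
          have h1 : Tendsto (fun n : ℕ => 1 / Real.sqrt n) atTop (𝓝 0) := by
            simp_rw [one_div]
            exact tendsto_inv_atTop_zero.comp
              (Real.tendsto_sqrt_atTop.comp tendsto_natCast_atTop_atTop)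
          simpa [c] using ((h1.mul_const (γ x)).neg).abs
        have hω0 : Tendsto (fun n : ℕ => ∫⁻ u in Set.Ioc (0 : ℝ) 1, ω x (c n x * u)) atTop
            (𝓝 0) := by
          rw [ENNReal.tendsto_nhds_zero]
          intro ε hε
          obtain ⟨δ, hδ, hδε⟩ := Metric.eventually_nhds_iff.1 (hcont.eventually (ge_mem_nhds hε))
          filter_upwards [hc0.eventually (gt_mem_nhds hδ)] with n hn
          refine hint x _ _ fun u hu => hδε ?_
          rw [Real.dist_eq, sub_zero, abs_mul, abs_of_pos hu.1]
          exact (mul_le_of_le_one_right (abs_nonneg _) hu.2).trans_lt hn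
        have := ENNReal.Tendsto.const_mul (a := ENNReal.ofReal (γ x ^ 2)) hω0
          (Or.inr ENNReal.ofReal_ne_top)
        rwa [mul_zero] at this

/-! ### Deviation of the target matrix under the null law -/

theorem measure_le_ofReal_of_integral_le {α : Type*} [MeasurableSpace α] {μ : Measure α}
    [IsProbabilityMeasure μ] {F : α → ℝ} (hF0 : ∀ x, 0 ≤ F x) (hF : Integrable F μ) {ε K : ℝ}
    (hε : 0 < ε) (hK : ∫ x, F x ∂μ ≤ K) :
    μ {x | ε ≤ F x} ≤ ENNReal.ofReal (K / ε) := by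
  have h := mul_meas_ge_le_integral_of_nonneg (Eventually.of_forall hF0) hF ε
  rw [← ofReal_measureReal]
  refine ENNReal.ofReal_le_ofReal ?_
  rw [le_div_iff₀ hε]
  linarith

theorem integral_sq_sum_of_orthogonal {α ι : Type*} [MeasurableSpace α] {μ : Measure α}
    {g : ι → α → ℝ} (s : Finset ι) (hg : ∀ i ∈ s, MemLp (g i) 2 μ)
    (ho : ∀ i ∈ s, ∀ j ∈ s, i ≠ j → ∫ x, g i x * g j x ∂μ = 0) :
    ∫ x, (∑ i ∈ s, g i x) ^ 2 ∂μ = ∑ i ∈ s, ∫ x, g i x ^ 2 ∂μ := by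
  have hint : ∀ i ∈ s, ∀ j ∈ s, Integrable (fun x => g i x * g j x) μ := fun i hi j hj =>
    (hg i hi).integrable_mul (hg j hj)
  simp_rw [sq, Finset.sum_mul_sum]
  rw [integral_finsetSum _ fun i hi => integrable_finsetSum _ fun j hj => hint i hi j hj]
  refine Finset.sum_congr rfl fun i hi => ?_
  rw [integral_finsetSum _ fun j hj => hint i hi j hj,
    Finset.sum_eq_single_of_mem i hi fun j hj hji => ho i hi j hj hji.symm]

section Sample

variable {E : Type*} [MeasurableSpace E] (P : Measure E) [IsProbabilityMeasure P] {n : ℕ}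

theorem iIndepFun_eval_pi :
    iIndepFun (fun (i : Fin n) (s : Fin n → E) => s i) (Measure.pi fun _ : Fin n => P) :=
  iIndepFun_pi (X := fun (_ : Fin n) => (id : E → E)) fun _ => aemeasurable_id

theorem map_eval_pi_const (i : Fin n) : (Measure.pi fun _ : Fin n => P).map (fun s => s i) = P :=
  (measurePreserving_eval (fun _ : Fin n => P) i).map_eq

theorem measurePreserving_eval_pair {k l : Fin n} (h : k ≠ l) :
    MeasurePreserving (fun s : Fin n → E => (s k, s l)) (Measure.pi fun _ : Fin n => P)
      (P.prod P) := by
  refine ⟨by fun_prop, ?_⟩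
  rw [((iIndepFun_eval_pi P).indepFun h).map_prod_eq_prod_map_map
    (measurable_pi_apply k).aemeasurable (measurable_pi_apply l).aemeasurable,
    map_eval_pi_const, map_eval_pi_const]

theorem measurePreserving_eval_triple {k l m : Fin n} (hkl : k ≠ l) (hkm : k ≠ m) (hlm : l ≠ m) :
    MeasurePreserving (fun s : Fin n → E => ((s k, s l), s m)) (Measure.pi fun _ : Fin n => P)
      ((P.prod P).prod P) := by
  refine ⟨by fun_prop, ?_⟩
  rw [((iIndepFun_eval_pi P).indepFun_prodMk (fun i => measurable_pi_apply i) k l m hkm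
    hlm).map_prod_eq_prod_map_map (by fun_prop) (measurable_pi_apply m).aemeasurable,
    (measurePreserving_eval_pair P hkl).map_eq, map_eval_pi_const]

theorem measure_sample_mean_deviation_le {m : E → ℝ} (hm : MemLp m 2 P) (hn : 0 < n) {c : ℝ}
    (hc : 0 < c) :
    Measure.pi (fun _ : Fin n => P) {s | c ≤ |(n : ℝ)⁻¹ * ∑ k, m (s k) - ∫ z, m z ∂P|}
      ≤ ENNReal.ofReal (Var[m; P] / n / c ^ 2) := by
  set μ := Measure.pi fun _ : Fin n => P
  have hn' : (n : ℝ) ≠ 0 := Nat.cast_ne_zero.2 hn.ne'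
  have hL : ∀ k : Fin n, MemLp (fun s : Fin n → E => m (s k)) 2 μ := fun k =>
    hm.comp_measurePreserving (measurePreserving_eval (fun _ : Fin n => P) k)
  have hid : ∀ k : Fin n, IdentDistrib (fun s : Fin n → E => m (s k)) m μ P := fun k =>
    ⟨(hL k).1.aemeasurable, hm.1.aemeasurable, by
      have hm' : AEMeasurable m (μ.map fun s => s k) := by
        rw [map_eval_pi_const]
        exact hm.1.aemeasurable
      have := AEMeasurable.map_map_of_aemeasurable hm' (measurable_pi_apply k).aemeasurable
      rw [map_eval_pi_const] at this
      exact this.symm⟩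
  have hind : iIndepFun (fun (k : Fin n) (s : Fin n → E) => m (s k)) μ :=
    iIndepFun_pi (X := fun (_ : Fin n) => m) fun _ => hm.1.aemeasurable
  have hmean : ∫ s, (n : ℝ)⁻¹ * ∑ k, m (s k) ∂μ = ∫ z, m z ∂P := by
    rw [integral_const_mul, integral_finsetSum _ fun k _ => (hL k).integrable (by norm_num),
      Finset.sum_congr rfl fun k _ => (hid k).integral_eq]
    simp [hn']
  have hvar : Var[fun s => (n : ℝ)⁻¹ * ∑ k, m (s k); μ] = Var[m; P] / n := by
    rw [variance_const_mul]
    have := IndepFun.variance_sum (s := Finset.univ) (fun k _ => hL k)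
      fun k _ l _ hkl => hind.indepFun hkl
    rw [Finset.sum_congr rfl fun k _ => (hid k).variance_eq] at this
    rw [show (fun s : Fin n → E => ∑ k, m (s k)) = ∑ k, fun s : Fin n → E => m (s k) by
      ext s; simp, this]
    simp only [Finset.sum_const, Finset.card_univ, Fintype.card_fin, nsmul_eq_mul]
    field_simp
  have hT : MemLp (fun s : Fin n → E => (n : ℝ)⁻¹ * ∑ k, m (s k)) 2 μ :=
    (memLp_finsetSum _ fun k _ => hL k).const_mul _
  have := meas_ge_le_variance_div_sq hT hc
  rwa [hmean, hvar] at this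

/-- The `n` diagonal terms carry weight `n⁻²`, so a first moment and Markov's inequality suffice. -/
theorem measure_diagonal_sum_le {m : E → ℝ} (hm : Integrable m P) (hn : 0 < n) {c : ℝ}
    (hc : 0 < c) :
    Measure.pi (fun _ : Fin n => P) {s | c ≤ |((n : ℝ) ^ 2)⁻¹ * ∑ k, m (s k)|}
      ≤ ENNReal.ofReal ((∫ z, |m z| ∂P) / n / c) := by
  have hn' : (n : ℝ) ≠ 0 := Nat.cast_ne_zero.2 hn.ne'
  have hL : ∀ k : Fin n, Integrable (fun s : Fin n → E => m (s k))
      (Measure.pi fun _ : Fin n => P) := fun k =>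
    (measurePreserving_eval (fun _ : Fin n => P) k).integrable_comp_of_integrable hm
  have hT := (integrable_finsetSum Finset.univ fun k _ => hL k).const_mul ((n : ℝ) ^ 2)⁻¹
  refine measure_le_ofReal_of_integral_le (fun s => abs_nonneg _) hT.abs hc ?_
  calc ∫ s, |((n : ℝ) ^ 2)⁻¹ * ∑ k, m (s k)| ∂(Measure.pi fun _ : Fin n => P)
      ≤ ∫ s, ((n : ℝ) ^ 2)⁻¹ * ∑ k, |m (s k)| ∂(Measure.pi fun _ : Fin n => P) := by
        refine integral_mono hT.abs
          ((integrable_finsetSum Finset.univ fun k _ => (hL k).abs).const_mul _) fun s => ?_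
        simp only [abs_mul, abs_inv, abs_pow, Nat.abs_cast]
        gcongr
        exact Finset.abs_sum_le_sum_abs _ _
    _ = (∫ z, |m z| ∂P) / n := by
        rw [integral_const_mul, integral_finsetSum _ fun k _ => (hL k).abs]
        have e : ∀ k : Fin n, ∫ s, |m (s k)| ∂(Measure.pi fun _ : Fin n => P) = ∫ z, |m z| ∂P := by
          intro k
          have hm' : AEStronglyMeasurable (fun z => |m z|)
              ((Measure.pi fun _ : Fin n => P).map fun s => s k) := by
            rw [map_eval_pi_const]
            exact hm.abs.1
          have hk : AEMeasurable (fun s : Fin n → E => s k) (Measure.pi fun _ : Fin n => P) :=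
            (measurable_pi_apply k).aemeasurable
          have := integral_map hk hm'
          rw [map_eval_pi_const] at this
          exact this.symm
        rw [Finset.sum_congr rfl fun k _ => e k]
        simp only [Finset.sum_const, Finset.card_univ, Fintype.card_fin, nsmul_eq_mul]
        field_simp

/-- For fixed `k` the terms are centred given `s k` and orthogonal across `l`, so each inner sum has
second moment at most `n V`. Cauchy–Schwarz over `k` then yields `V / n` after the scaling by `n⁻²`;
no orthogonality between different `k` is needed. -/
theorem measure_offdiagonal_sum_le {F : Type*} [MeasurableSpace F] {y : E → F} (hy : Measurable y)
    {φ : E × F → ℝ} (hφm : Measurable φ) (hφ : MemLp φ 2 (P.prod (P.map y)))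
    (hcen : ∀ t, ∫ z, φ (z, t) ∂P = 0) (hn : 0 < n) {c : ℝ} (hc : 0 < c) :
    Measure.pi (fun _ : Fin n => P)
        {s | c ≤ |((n : ℝ) ^ 2)⁻¹ * ∑ k, ∑ l ∈ Finset.univ.erase k, φ (s l, y (s k))|}
      ≤ ENNReal.ofReal ((∫ w, φ w ^ 2 ∂(P.prod (P.map y))) / n / c ^ 2) := by
  set μ := Measure.pi fun _ : Fin n => P
  set V := ∫ w, φ w ^ 2 ∂(P.prod (P.map y))
  have hn' : (n : ℝ) ≠ 0 := Nat.cast_ne_zero.2 hn.ne'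
  have hyp : MeasurePreserving y P (P.map y) := hy.measurePreserving P
  have : IsProbabilityMeasure (P.map y) := Measure.isProbabilityMeasure_map hy.aemeasurable
  have hpp : MeasurePreserving (fun w : E × E => (w.1, y w.2)) (P.prod P) (P.prod (P.map y)) :=
    (MeasurePreserving.id P).prod hyp
  set φ' : E × E → ℝ := fun w => φ (w.1, y w.2)
  have hφ'm : Measurable φ' := hφm.comp hpp.measurable
  have hφ' : MemLp φ' 2 (P.prod P) := hφ.comp_measurePreserving hpp
  have hV : ∫ w, φ' w ^ 2 ∂(P.prod P) = V := by
    have := integral_map (μ := P.prod P) hpp.measurable.aemeasurable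
      (f := fun w => φ w ^ 2) (hφm.pow_const 2).aestronglyMeasurable
    rw [hpp.map_eq] at this
    exact this.symm
  have hL : ∀ k l : Fin n, l ≠ k → MemLp (fun s : Fin n → E => φ' (s l, s k)) 2 μ :=
    fun k l h => hφ'.comp_measurePreserving (measurePreserving_eval_pair P h)
  have hsq : ∀ k l : Fin n, l ≠ k → ∫ s, φ' (s l, s k) ^ 2 ∂μ = V := by
    intro k l h
    have hmp := measurePreserving_eval_pair P h
    have := integral_map (μ := μ) hmp.measurable.aemeasurable
      (f := fun w => φ' w ^ 2) (hφ'm.pow_const 2).aestronglyMeasurable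
    rw [hmp.map_eq, hV] at this
    exact this.symm
  -- The coordinate `s m` enters only the second factor, so integrating over it first gives zero by
  -- centring.
  have hort : ∀ k l m : Fin n, l ≠ k → m ≠ k → l ≠ m →
      ∫ s, φ' (s l, s k) * φ' (s m, s k) ∂μ = 0 := by
    intro k l m hlk hmk hlm
    have hmp := measurePreserving_eval_triple P hlk hlm hmk.symm
    have hprod : Measurable fun w : (E × E) × E => φ' w.1 * φ' (w.2, w.1.2) :=
      (hφ'm.comp measurable_fst).mul
        (hφ'm.comp (measurable_snd.prodMk (measurable_snd.comp measurable_fst)))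
    have hi : Integrable (fun w : (E × E) × E => φ' w.1 * φ' (w.2, w.1.2)) ((P.prod P).prod P) := by
      have := (hL k l hlk).integrable_mul (hL k m hmk)
      rw [← hmp.map_eq, integrable_map_measure hprod.aestronglyMeasurable
        hmp.measurable.aemeasurable]
      exact this
    have := integral_map (μ := μ) hmp.measurable.aemeasurable hprod.aestronglyMeasurable
    rw [hmp.map_eq, integral_prod _ hi] at this
    rw [← this]
    simp_rw [integral_const_mul]
    simp [φ', hcen]
  set S : Fin n → (Fin n → E) → ℝ := fun k s => ∑ l ∈ Finset.univ.erase k, φ' (s l, s k)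
  have hS : ∀ k, MemLp (S k) 2 μ := fun k =>
    memLp_finsetSum _ fun l hl => hL k l (Finset.ne_of_mem_erase hl)
  have hV0 : 0 ≤ V := integral_nonneg fun w => sq_nonneg _
  have hS2 : ∀ k, ∫ s, S k s ^ 2 ∂μ ≤ n * V := by
    intro k
    rw [integral_sq_sum_of_orthogonal _ (fun l hl => hL k l (Finset.ne_of_mem_erase hl))
      fun l hl m hm hlm => hort k l m (Finset.ne_of_mem_erase hl) (Finset.ne_of_mem_erase hm) hlm,
      Finset.sum_congr rfl fun l hl => hsq k l (Finset.ne_of_mem_erase hl), Finset.sum_const,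
      nsmul_eq_mul]
    gcongr
    simp
  have hT : MemLp (fun s => ((n : ℝ) ^ 2)⁻¹ * ∑ k, S k s) 2 μ :=
    (memLp_finsetSum _ fun k _ => hS k).const_mul _
  have hset : {s : Fin n → E | c ≤ |((n : ℝ) ^ 2)⁻¹ * ∑ k, S k s|}
      = {s | c ^ 2 ≤ (((n : ℝ) ^ 2)⁻¹ * ∑ k, S k s) ^ 2} := by
    ext s
    rw [Set.mem_ofPred_eq, Set.mem_ofPred_eq, ← sq_abs (((n : ℝ) ^ 2)⁻¹ * _),
      sq_le_sq₀ hc.le (abs_nonneg _)]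
  change μ {s : Fin n → E | c ≤ |((n : ℝ) ^ 2)⁻¹ * ∑ k, S k s|} ≤ _
  rw [hset]
  refine measure_le_ofReal_of_integral_le (fun s => sq_nonneg _) hT.integrable_sq (by positivity) ?_
  calc ∫ s, (((n : ℝ) ^ 2)⁻¹ * ∑ k, S k s) ^ 2 ∂μ
      ≤ ∫ s, (((n : ℝ) ^ 2)⁻¹) ^ 2 * (n * ∑ k, S k s ^ 2) ∂μ := by
        refine integral_mono hT.integrable_sq
          (((integrable_finsetSum _ fun k _ => (hS k).integrable_sq).const_mul _).const_mul _)
          fun s => ?_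
        simp only [mul_pow]
        gcongr
        simpa using sq_sum_le_card_mul_sum_sq (s := Finset.univ) (f := fun k => S k s)
    _ = (((n : ℝ) ^ 2)⁻¹) ^ 2 * (n * ∑ k, ∫ s, S k s ^ 2 ∂μ) := by
        rw [integral_const_mul, integral_const_mul,
          integral_finsetSum _ fun k _ => (hS k).integrable_sq]
    _ ≤ (((n : ℝ) ^ 2)⁻¹) ^ 2 * (n * ∑ _k : Fin n, n * V) := by
        gcongr with k _
        exact hS2 k
    _ = V / n := by
        simp only [Finset.sum_const, Finset.card_univ, Fintype.card_fin, nsmul_eq_mul]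
        field_simp

end Sample

theorem abs_entry_le_frobNorm {p : ℕ} (A : Matrix (Fin p) (Fin p) ℝ) (i j : Fin p) :
    |A i j| ≤ frobNorm A := by
  refine Real.abs_le_sqrt ?_
  refine (Finset.single_le_sum (f := fun j => A i j ^ 2) (fun _ _ => sq_nonneg _)
    (Finset.mem_univ j)).trans ?_
  exact Finset.single_le_sum (f := fun i => ∑ j, A i j ^ 2)
    (fun _ _ => Finset.sum_nonneg fun _ _ => sq_nonneg _) (Finset.mem_univ i)

/-- The thresholds are the sample responses themselves, so averaging the linear expansion produces a
V-statistic in `ψ`. Its diagonal is split off because there only integrability is available. -/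
theorem deeMatrix_sub_eq {p n : ℕ} (hn : 0 < n) (Mhat : KernelEstimator p)
    (M : ℝ → Matrix (Fin p) (Fin p) ℝ) (ψ : Cov p × ℝ → ℝ → Matrix (Fin p) (Fin p) ℝ)
    (s : Fin n → Cov p × ℝ) (i j : Fin p) (e : ℝ) :
    deeMatrix Mhat s i j - e = ((n : ℝ)⁻¹ * ∑ k, M (s k).2 i j - e)
      + ((n : ℝ) ^ 2)⁻¹ * ∑ k, ∑ l ∈ Finset.univ.erase k, ψ (s l) (s k).2 i j
      + ((n : ℝ) ^ 2)⁻¹ * ∑ k, ψ (s k) (s k).2 i j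
      + (n : ℝ)⁻¹ * ∑ k, kernelRemainder Mhat M ψ s (s k).2 i j := by
  have hn' : (n : ℝ) ≠ 0 := Nat.cast_ne_zero.2 hn.ne'
  have h1 : ∀ k, kernelRemainder Mhat M ψ s (s k).2 i j = Mhat n s (s k).2 i j - M (s k).2 i j
      - (n : ℝ)⁻¹ * (∑ l ∈ Finset.univ.erase k, ψ (s l) (s k).2 i j + ψ (s k) (s k).2 i j) := by
    intro k
    rw [Finset.sum_erase_add _ _ (Finset.mem_univ k)]
    simp [kernelRemainder, Matrix.sum_apply]
  simp_rw [h1, Finset.sum_sub_distrib, ← Finset.mul_sum, Finset.sum_add_distrib]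
  simp only [deeMatrix, Matrix.smul_apply, Matrix.sum_apply, smul_eq_mul]
  field_simp
  ring

/-- Under the null law, each entry of the target matrix is estimated with an error of smaller
order than `√(log n / n)`. -/
theorem DEERegular.tendsto_measure_entry_deviation {p : ℕ} {P : Measure (Cov p × ℝ)}
    [IsProbabilityMeasure P] {Mhat : KernelEstimator p} {M : ℝ → Matrix (Fin p) (Fin p) ℝ}
    {ψ : Cov p × ℝ → ℝ → Matrix (Fin p) (Fin p) ℝ} (hreg : DEERegular P Mhat M ψ) (i j : Fin p) :
    Tendsto (fun n : ℕ => Measure.pi (fun _ : Fin n => P)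
      {s | Real.sqrt (Real.log n / n) < |deeMatrix Mhat s i j - ∫ z, M z.2 i j ∂P|})
      atTop (𝓝 0) := by
  set V₁ := Var[fun z : Cov p × ℝ => M z.2 i j; P]
  set V₂ := ∫ w : (Cov p × ℝ) × ℝ, ψ w.1 w.2 i j ^ 2 ∂(P.prod (P.map Prod.snd))
  set V₃ := ∫ z, |ψ z z.2 i j| ∂P
  have hV₃ : 0 ≤ V₃ := integral_nonneg fun _ => abs_nonneg _
  set D : (n : ℕ) → Set (Fin n → Cov p × ℝ) := fun n =>
    {s | ∃ t : ℝ, 1 < Real.sqrt n * frobNorm (kernelRemainder Mhat M ψ s t)}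
  have hlog : Tendsto (fun n : ℕ => Real.log n) atTop atTop :=
    Real.tendsto_log_atTop.comp tendsto_natCast_atTop_atTop
  have hbound : ∀ᶠ n : ℕ in atTop, Measure.pi (fun _ : Fin n => P)
      {s | Real.sqrt (Real.log n / n) < |deeMatrix Mhat s i j - ∫ z, M z.2 i j ∂P|}
      ≤ ENNReal.ofReal (16 * V₁ / Real.log n) + ENNReal.ofReal (16 * V₂ / Real.log n)
        + ENNReal.ofReal (4 * V₃ / Real.log n) + Measure.pi (fun _ : Fin n => P) (D n) := by
    -- Each of the four error terms is allotted a quarter of `√(log n / n)`; `log n ≥ 16` is what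
    -- makes `1/√n`, the bound on the remainder, fit into its quarter.
    filter_upwards [hlog.eventually_ge_atTop 16, eventually_gt_atTop 0] with n hn hn0
    have hnR : (0 : ℝ) < n := Nat.cast_pos.2 hn0
    have hlogpos : 0 < Real.log n := by linarith
    set a := Real.sqrt (Real.log n / n)
    have ha2 : a ^ 2 = Real.log n / n := Real.sq_sqrt (by positivity)
    have ha : 0 < a := Real.sqrt_pos.2 (by positivity)
    have hc : 0 < a / 4 := by positivity
    have h1 := measure_sample_mean_deviation_le P (hreg.sq_integrable_kernel i j) hn0 hc
    have h2 := measure_offdiagonal_sum_le P measurable_snd (hreg.measurable_influence i j)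
      (hreg.sq_integrable_influence i j) (fun t => hreg.centered_influence t i j) hn0 hc
    have h3 := measure_diagonal_sum_le P (hreg.integrable_influence_diag i j) hn0 hc
    have hsub : {s : Fin n → Cov p × ℝ | a < |deeMatrix Mhat s i j - ∫ z, M z.2 i j ∂P|}
        ⊆ (({s | a / 4 ≤ |(n : ℝ)⁻¹ * ∑ k, M (s k).2 i j - ∫ z, M z.2 i j ∂P|}
          ∪ {s | a / 4 ≤ |((n : ℝ) ^ 2)⁻¹ * ∑ k, ∑ l ∈ Finset.univ.erase k, ψ (s l) (s k).2 i j|})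
          ∪ {s | a / 4 ≤ |((n : ℝ) ^ 2)⁻¹ * ∑ k, ψ (s k) (s k).2 i j|}) ∪ D n := by
      intro s hs
      by_contra hcon
      simp only [Set.mem_union, not_or, Set.mem_ofPred_eq, not_le, D, not_exists, not_lt] at hcon
      obtain ⟨⟨⟨c1, c2⟩, c3⟩, c4⟩ := hcon
      have hR : |(n : ℝ)⁻¹ * ∑ k, kernelRemainder Mhat M ψ s (s k).2 i j| ≤ a / 4 := by
        have hsn : 0 < Real.sqrt n := Real.sqrt_pos.2 hnR
        have hRk : ∀ k, |kernelRemainder Mhat M ψ s (s k).2 i j| ≤ a / 4 := by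
          intro k
          have := c4 (s k).2
          have h5 : frobNorm (kernelRemainder Mhat M ψ s (s k).2) ≤ 1 / Real.sqrt n := by
            rw [le_div_iff₀ hsn]
            linarith
          refine (abs_entry_le_frobNorm _ i j).trans (h5.trans ?_)
          refine (sq_le_sq₀ (by positivity) hc.le).1 ?_
          rw [div_pow, div_pow, ha2, Real.sq_sqrt hnR.le, div_div, mul_comm (n : ℝ), ← div_div]
          gcongr
          rw [one_pow, le_div_iff₀ (by norm_num)]
          linarith
        rw [abs_mul, abs_inv, Nat.abs_cast]
        calc (n : ℝ)⁻¹ * |∑ k, kernelRemainder Mhat M ψ s (s k).2 i j|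
            ≤ (n : ℝ)⁻¹ * ∑ _k : Fin n, a / 4 := by
              gcongr
              exact (Finset.abs_sum_le_sum_abs _ _).trans (Finset.sum_le_sum fun k _ => hRk k)
          _ = a / 4 := by
              simp only [Finset.sum_const, Finset.card_univ, Fintype.card_fin, nsmul_eq_mul]
              field_simp
      have hs' : a < |deeMatrix Mhat s i j - ∫ z, M z.2 i j ∂P| := hs
      rw [deeMatrix_sub_eq hn0 Mhat M ψ] at hs'
      have t1 := abs_add_le
        (((n : ℝ)⁻¹ * ∑ k, M (s k).2 i j - ∫ z, M z.2 i j ∂P)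
          + ((n : ℝ) ^ 2)⁻¹ * ∑ k, ∑ l ∈ Finset.univ.erase k, ψ (s l) (s k).2 i j
          + ((n : ℝ) ^ 2)⁻¹ * ∑ k, ψ (s k) (s k).2 i j)
        ((n : ℝ)⁻¹ * ∑ k, kernelRemainder Mhat M ψ s (s k).2 i j)
      have t2 := abs_add_three ((n : ℝ)⁻¹ * ∑ k, M (s k).2 i j - ∫ z, M z.2 i j ∂P)
        (((n : ℝ) ^ 2)⁻¹ * ∑ k, ∑ l ∈ Finset.univ.erase k, ψ (s l) (s k).2 i j)
        (((n : ℝ) ^ 2)⁻¹ * ∑ k, ψ (s k) (s k).2 i j)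
      linarith
    refine (measure_mono hsub).trans ((measure_union_le _ _).trans ?_)
    gcongr
    refine (measure_union_le _ _).trans ?_
    refine add_le_add ((measure_union_le _ _).trans (add_le_add ?_ ?_)) ?_
    · refine h1.trans_eq ?_
      rw [div_pow, ha2]
      congr 1
      field_simp
      norm_num
      exact mul_comm _ _
    · refine h2.trans_eq ?_
      rw [div_pow, ha2]
      congr 1
      field_simp
      norm_num
      exact mul_comm _ _
    · refine h3.trans (ENNReal.ofReal_le_ofReal ?_)
      -- Here `n a = √(n log n)`, which weakens the diagonal bound to the common form `const / log
      -- n`.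
      have hna : Real.log n ≤ n * a := by
        refine (sq_le_sq₀ hlogpos.le (by positivity)).1 ?_
        rw [mul_pow, ha2]
        have := Real.log_le_self hnR.le
        have e : (n : ℝ) ^ 2 * (Real.log n / n) = n * Real.log n := by field_simp
        rw [e, sq]
        gcongr
      have e : V₃ / n / (a / 4) = 4 * V₃ / (n * a) := by field_simp
      rw [e]
      gcongr
  have hz : ∀ K : ℝ, Tendsto (fun n : ℕ => ENNReal.ofReal (K / Real.log n)) atTop (𝓝 0) := by
    intro K
    have := ENNReal.tendsto_ofReal (hlog.const_div_atTop K)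
    rwa [ENNReal.ofReal_zero] at this
  have hlim := (((hz (16 * V₁)).add (hz (16 * V₂))).add (hz (4 * V₃))).add
    (hreg.remainder 1 one_pos)
  simp only [add_zero] at hlim
  exact tendsto_of_tendsto_of_tendsto_of_le_of_le' tendsto_const_nhds hlim
    (Eventually.of_forall fun _ => zero_le) hbound

/-! ### From entrywise closeness to the estimated dimension -/

theorem isHermitian_deeMatrix {p n : ℕ} {Mhat : KernelEstimator p}
    (h : ∀ n s t, (Mhat n s t).IsHermitian) (s : Fin n → Cov p × ℝ) :
    (deeMatrix Mhat s).IsHermitian := by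
  refine Matrix.IsHermitian.ext fun i j => ?_
  simp only [deeMatrix, Matrix.smul_apply, Matrix.sum_apply, star_trivial]
  congr 1
  exact Finset.sum_congr rfl fun k _ => by simpa using (h n s (s k).2).apply i j

/-- A minimum ridge ratio estimate equals one if the entries of the matrix are close to those of a
matrix of rank one, relative to the ridge. -/
theorem eventually_ridgeRatioEstimate_eq_one {p : ℕ} {b : Cov p} (hb : b ≠ 0) {κ : ℝ}
    (hκ : 0 < κ) :
    ∀ᶠ n : ℕ in atTop, ∀ (A : Matrix (Fin p) (Fin p) ℝ) (k : ℕ), A.IsHermitian →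
      (∀ i j, |A i j - κ * (b i * b j)| ≤ Real.sqrt (Real.log n / n)) →
      IsRidgeRatioEstimate A (Real.log n / n) k → k = 1 := by
  -- Half the limiting top eigenvalue: the perturbation `p √c` is eventually below `m`. The other
  -- eigenvalues are at most `p √c`, hence the choice `K = p²`.
  set m : ℝ := κ * ‖b‖ ^ 2 / 2
  have hm : 0 < m := by positivity
  have hc : Tendsto (fun n : ℕ => Real.log n / n) atTop (𝓝 0) :=
    (Real.isLittleO_log_id_atTop.tendsto_div_nhds_zero).comp tendsto_natCast_atTop_atTop
  have hs : Tendsto (fun n : ℕ => p * Real.sqrt (Real.log n / n)) atTop (𝓝 0) := by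
    have := ((Real.continuous_sqrt.tendsto 0).comp hc).const_mul (p : ℝ)
    simpa using this
  have hcK : Tendsto (fun n : ℕ => Real.log n / n * ((p : ℝ) ^ 2 + 1) ^ 2) atTop (𝓝 0) := by
    simpa using hc.mul_const (((p : ℝ) ^ 2 + 1) ^ 2)
  filter_upwards [hs.eventually (ge_mem_nhds hm),
    hcK.eventually (ge_mem_nhds (show (0 : ℝ) < m ^ 2 by positivity)), eventually_gt_atTop 1]
    with n h1 h2 hn A k hA hent hk
  have hn1 : (1 : ℝ) < n := by exact_mod_cast hn
  have hcpos : 0 < Real.log n / n := div_pos (Real.log_pos hn1) (by linarith)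
  obtain ⟨hsm, hlg⟩ := orderedEigenvalue_near_rank_one hA hκ.le (by positivity)
    (abs_inner_toEuclideanLin_sub_le hent)
  refine hk.eq_one (K := (p : ℝ) ^ 2) (m := m) hcpos (by positivity) hm.le (fun i hi => ?_) ?_ h2
  · rw [← sq_abs]
    calc |orderedEigenvalue A i| ^ 2 ≤ (p * Real.sqrt (Real.log n / n)) ^ 2 := by
          gcongr
          exact hsm i hi
      _ = (p : ℝ) ^ 2 * (Real.log n / n) := by rw [mul_pow, Real.sq_sqrt hcpos.le]
  · have := hlg hb
    have e : κ * ‖b‖ ^ 2 = 2 * m := by simp only [m]; ring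
    linarith

theorem response_eq_response_zero_add {p d q : ℕ} (g : ℝ → EuclideanSpace ℝ (Fin d) → ℝ)
    (β₀ : Cov p) (θ₀ : EuclideanSpace ℝ (Fin d)) (G : EuclideanSpace ℝ (Fin q) → ℝ)
    (B : Matrix (Fin p) (Fin q) ℝ) (C : ℝ) (x : Cov p) (e : ℝ) :
    response g β₀ θ₀ G B C x e = response g β₀ θ₀ G B 0 x e
      + C * G (Matrix.toEuclideanLin B.transpose x) := by
  simp only [response]
  ring

/-- The law of a sample from independent observations with a common law. -/
theorem map_sample_eq_pi {Ω E F : Type*} [MeasurableSpace Ω] [MeasurableSpace E]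
    [MeasurableSpace F] {μ : Measure Ω} [IsProbabilityMeasure μ] {Z : ℕ → Ω → E}
    (hZ : iIndepFun Z μ) {T : E → F} {Q : Measure F} (hT : Measurable T)
    (hZm : ∀ i, Measurable (Z i)) (hlaw : ∀ i, μ.map (fun ω => T (Z i ω)) = Q) (n : ℕ) :
    μ.map (fun ω (i : Fin n) => T (Z i ω)) = Measure.pi fun _ : Fin n => Q := by
  have h1 : iIndepFun (fun (i : Fin n) ω => T (Z i ω)) μ :=
    (hZ.comp (fun _ => T) fun _ => hT).precomp Fin.val_injective
  have h2 : ∀ i : Fin n, AEMeasurable (fun ω => T (Z i ω)) μ := fun i =>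
    (hT.comp (hZm i)).aemeasurable
  rw [(iIndepFun_iff_map_fun_eq_pi_map h2).1 h1]
  simp_rw [hlaw]

theorem lemma2 {p d q : ℕ} {Ω : Type*} [MeasurableSpace Ω] (μ : Measure Ω) [IsProbabilityMeasure μ]
    -- covariates and errors
    (X : ℕ → Ω → Cov p) (η : ℕ → Ω → ℝ)
    (hX : ∀ i, Measurable (X i)) (hη : ∀ i, Measurable (η i))
    (hindep : iIndepFun (fun i ω => (X i ω, η i ω)) μ)
    (hint : ∀ i, Integrable (η i) μ)
    (hmean : ∀ i, μ[η i | MeasurableSpace.comap (X i) inferInstance] =ᵐ[μ] 0)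
    -- regression functions
    (g : ℝ → EuclideanSpace ℝ (Fin d) → ℝ) (β₀ : Cov p) (θ₀ : EuclideanSpace ℝ (Fin d))
    (G : EuclideanSpace ℝ (Fin q) → ℝ) (B : Matrix (Fin p) (Fin q) ℝ)
    (hg : Measurable (fun u => g u θ₀)) (hG : Measurable G)
    (hBorth : (B.transpose * B).IsDiag) (hBcol : ∀ j, B.col j ≠ 0)
    (hβ₀ : β₀ ≠ 0) (hβB : β₀ ∈ LinearMap.range (Matrix.toEuclideanLin B))
    -- the law of the covariate and the response in the null model
    (P : Measure (Cov p × ℝ)) [IsProbabilityMeasure P]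
    (hlaw : ∀ i, HasLaw (fun ω => (X i ω, response g β₀ θ₀ G B 0 (X i ω) (η i ω))) P μ)
    (hcentral : IsCentralSubspace P Prod.snd (Submodule.span ℝ {β₀}))
    (hinfo : FiniteLocationInformation P
      (fun x => G (Matrix.toEuclideanLin B.transpose x)))
    -- the dimension reduction method and its regularity conditions
    (Mhat : KernelEstimator p) (M : ℝ → Matrix (Fin p) (Fin p) ℝ)
    (ψ : Cov p × ℝ → ℝ → Matrix (Fin p) (Fin p) ℝ)
    (hreg : DEERegular P Mhat M ψ)
    -- the estimated dimension, computed from the sample of size `n` under the local alternative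
    (qhat : ℕ → Ω → ℕ)
    (hqhat : ∀ n ω, IsRidgeRatioEstimate
      (deeMatrix Mhat (fun i : Fin n =>
        (X i ω, response g β₀ θ₀ G B (1 / Real.sqrt n) (X i ω) (η i ω))))
      (Real.log n / n) (qhat n ω)) :
    Tendsto (fun n => μ {ω | qhat n ω = 1}) atTop (𝓝 1) := by
  set γ : Cov p → ℝ := fun x => G (Matrix.toEuclideanLin B.transpose x)
  have hlin : Measurable fun x : Cov p => Matrix.toEuclideanLin B.transpose x :=
    (LinearMap.continuous_of_finiteDimensional _).measurable
  have hγ : Measurable γ := hG.comp hlin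
  have hres : ∀ C : ℝ, Measurable fun z : Cov p × ℝ =>
      (z.1, response g β₀ θ₀ G B C z.1 z.2) := by
    intro C
    have h1 : Measurable fun z : Cov p × ℝ => inner ℝ β₀ z.1 :=
      ((continuous_const.inner continuous_id).measurable).comp measurable_fst
    exact measurable_fst.prodMk
      (((hg.comp h1).add ((hγ.comp measurable_fst).const_mul C)).add measurable_snd)
  have := hinfo.nullSingletonClass
  obtain ⟨κ, hκ, hmean'⟩ := hreg.exists_integral_kernel hβ₀ hcentral
  -- the exceptional event under the null law
  set S : (n : ℕ) → Set (Fin n → Cov p × ℝ) := fun n => ⋃ i, ⋃ j,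
    {s | Real.sqrt (Real.log n / n) < |deeMatrix Mhat s i j - ∫ z, M z.2 i j ∂P|}
  have hS : Tendsto (fun n => Measure.pi (fun _ : Fin n => P) (S n)) atTop (𝓝 0) := by
    have hsum := tendsto_finsetSum Finset.univ fun i _ => tendsto_finsetSum Finset.univ
      fun j _ => hreg.tendsto_measure_entry_deviation i j
    simp only [Finset.sum_const_zero] at hsum
    refine tendsto_of_tendsto_of_tendsto_of_le_of_le tendsto_const_nhds hsum
      (fun _ => zero_le) fun n => ?_
    refine (measure_iUnion_fintype_le _ _).trans (Finset.sum_le_sum fun i _ => ?_)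
    exact measure_iUnion_fintype_le _ _
  -- The only passage from the null to the alternative; everything about the estimator enters
  -- through `S n`.
  have hS' := hinfo.tendsto_pi_map_shift hγ hS
  set Q : ℕ → Measure (Cov p × ℝ) := fun n => P.map fun z => (z.1, z.2 + 1 / Real.sqrt n * γ z.1)
  set sample : (n : ℕ) → Ω → Fin n → Cov p × ℝ := fun n ω i =>
    (X i ω, response g β₀ θ₀ G B (1 / Real.sqrt n) (X i ω) (η i ω))
  have hZm : ∀ i, Measurable fun ω => (X i ω, η i ω) := fun i => (hX i).prodMk (hη i)
  have hsample : ∀ n, μ.map (sample n) = Measure.pi fun _ : Fin n => Q n := by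
    intro n
    refine map_sample_eq_pi hindep (hres (1 / Real.sqrt n)) hZm (fun i => ?_) n
    have hshift : Measurable fun z : Cov p × ℝ => (z.1, z.2 + 1 / Real.sqrt n * γ z.1) := by
      fun_prop
    simp only [Q]
    have hnull : Measurable fun ω => (X i ω, response g β₀ θ₀ G B 0 (X i ω) (η i ω)) :=
      (hres 0).comp (hZm i)
    rw [← (hlaw i).map_eq, Measure.map_map hshift hnull]
    congr 1
    ext1 ω
    exact Prod.ext rfl (response_eq_response_zero_add g β₀ θ₀ G B (1 / Real.sqrt n) _ _)
  have hsm : ∀ n, Measurable (sample n) := fun n =>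
    measurable_pi_lambda _ fun i => (hres (1 / Real.sqrt n)).comp (hZm i)
  -- Taking a hull makes `N n` measurable, and `(N n)ᶜ` eventually lies inside `{qhat n = 1}`, so
  -- neither `S n` nor `qhat` has to be shown measurable.
  set N : (n : ℕ) → Set Ω := fun n =>
    sample n ⁻¹' toMeasurable (Measure.pi fun _ : Fin n => Q n) (S n)
  have hNm : ∀ n, MeasurableSet (N n) := fun n => hsm n (measurableSet_toMeasurable _ _)
  have hN : Tendsto (fun n => μ (N n)) atTop (𝓝 0) := by
    refine hS'.congr fun n => ?_
    rw [← measure_toMeasurable, ← hsample, Measure.map_apply (hsm n)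
      (measurableSet_toMeasurable _ _), hsample]
  have hNc : Tendsto (fun n => μ (N n)ᶜ) atTop (𝓝 1) := by
    simp_rw [prob_compl_eq_one_sub (hNm _)]
    simpa using ENNReal.Tendsto.sub tendsto_const_nhds hN (Or.inl ENNReal.one_ne_top)
  refine tendsto_of_tendsto_of_tendsto_of_le_of_le' hNc tendsto_const_nhds ?_
    (Eventually.of_forall fun n => prob_le_one)
  filter_upwards [eventually_ridgeRatioEstimate_eq_one hβ₀ hκ] with n hn
  refine measure_mono fun ω hω => ?_
  have hωS : sample n ω ∉ S n := fun h => hω (subset_toMeasurable _ _ h)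
  refine hn _ _ (isHermitian_deeMatrix hreg.symm_estimator (sample n ω)) (fun i j => ?_)
    (hqhat n ω)
  by_contra hlt
  refine hωS (Set.mem_iUnion.2 ⟨i, Set.mem_iUnion.2 ⟨j, ?_⟩⟩)
  rw [Set.mem_ofPred_eq, hmean']
  exact not_le.1 hlt
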